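/- Consider the matrix deletion channel with constant deletion probability $p\in[0,1)$ and retention probability $q=1-p$: a trace of a binary $N\times N$ matrix $X$, with $n=N^2$ entries, is obtained by deleting every row and every column independently with probability $p$. Let $X\in\{0,1\}^{N\times N}$ be uniformly random, and let the traces be independent given $X$. A trace of a string $x\in\{0,1\}^N$ is obtained by deleting each bit independently with probability $p$. Constants below may depend on $p$ only, and all limits are for $N\to\infty$. For strings $t,t'$ put $w=\lceil 100\,n^{1/4}\sqrt{\log n/q}\,\rceil$, $g=\lceil 96/q^2\rceil$ and, for $i\ge 0$, $$Z_i=\Big(\sum_{j=2wi}^{2wi+w-1}(t_j-t'_j)\Big)^2,\qquad z_j=\sum_{i=0}^{g-1}Z_{jg+i},$$ where positions start at $0$ and $t_j=0$ (resp. $t'_j=0$) beyond the end of the string. For $c>0$ let $D_c(t,t')$ be the median of $z_0,\dots,z_{2L}$ with $L=\lceil c\log n\rceil$. The median test with parameter $c$ declares that $t$ and $t'$ come from the same string if $D_c(t,t')<(1-q/4)gw/2$, and that they come from different strings otherwise. (a) There are constants $C>0$ and $c_0>0$ such that the following holds with $m=\lceil C\log n\rceil$ traces. (i) There are reconstruction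 maps $\Phi_N$ from $m$-tuples of matrix traces to $\{0,1\}^{N\times N}$ with $\Pr[\Phi_N(\tilde X_1,\dots,\tilde X_m)=X]\to 1$, over the randomness of $X$ and of the channel. (ii) For every $c\ge c_0$ and all sufficiently large $N$: if $t,t'$ are two independent traces of the same uniformly random $x\in\{0,1\}^N$, then $\Pr[D_c(t,t')<(1-q/4)gw/2]\ge 1-n^{-10}$; if $t,t'$ are independent traces of two independent uniformly random strings $x,y\in\{0,1\}^N$, then $\Pr[D_c(t,t')\ge(1-q/4)gw/2]\ge 1-n^{-10}$. (iii) For every $c\ge c_0$ the test aligns the rows and columns across the traces: call an assignment of labels in $\{1,\dots,N\}$ to the rows and to the columns of all traces, strictly increasing within each trace, aligned if any two rows of different traces get the same label exactly when the median test with parameter $c$ declares that they come from the same string, and likewise for columns. With probability tending to $1$ over $X$ and the channel, the assignment of the true original row and column indices is aligned and is the only aligned one, and $X$ is the only $N\times N$ binary matrix whose entries at the positions given by this assignment are the received entries. (b) The order $\log n$ is optimal: if $0<p<1$, there is a constant $b>0$ such that, for every sequence $m=m(N)$ with $m(N)\le b\log n$ for all large $N$ and every sequence of (possibly randomized) reconstruction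 procedures using $m(N)$ traces, the probability of outputting $X$ tends to $0$. -/

import Mathlib

open Filter Topology MeasureTheory ProbabilityTheory

noncomputable section

namespace MatrixReconstruction

/-! ### The deletion channel -/

/-- A retention pattern on `N` positions: `κ i = true` means that position `i` is retained. -/
abbrev Pattern (N : ℕ) := Fin N → Bool

/-- The retained positions. -/
def kept {N : ℕ} (κ : Pattern N) : Finset (Fin N) := Finset.univ.filter fun i => κ i = true

/-- `origin κ k` is the original position of the `k`-th retained position. -/
def origin {N : ℕ} (κ : Pattern N) : Fin (kept κ).card ↪o Fin N :=
  (kept κ).orderEmbOfFin rfl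

/-- The trace of the string `x` under the retention pattern `κ`. -/
def stringTrace {N : ℕ} (x : Fin N → Bool) (κ : Pattern N) : List Bool :=
  List.ofFn fun k => x (origin κ k)

/-- A binary matrix of arbitrary dimensions, as received from the matrix deletion channel. -/
structure MatrixTrace where
  rows : ℕ
  cols : ℕ
  entry : Fin rows → Fin cols → Bool

/-- The `k`-th row of a matrix trace, as a string. -/
def MatrixTrace.row (T : MatrixTrace) (k : Fin T.rows) : List Bool :=
  List.ofFn fun l => T.entry k l

/-- The `l`-th column of a matrix trace, as a string. -/
def MatrixTrace.col (T : MatrixTrace) (l : Fin T.cols) : List Bool :=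
  List.ofFn fun k => T.entry k l

/-- The trace of the matrix `X` when rows are retained according to `κ.1` and columns according
to `κ.2`. -/
def matrixTrace {N : ℕ} (X : Fin N → Fin N → Bool) (κ : Pattern N × Pattern N) : MatrixTrace where
  rows := (kept κ.1).card
  cols := (kept κ.2).card
  entry := fun k l => X (origin κ.1 k) (origin κ.2 l)

/-! ### The probability laws -/

/-- Each position is deleted (`false`) with probability `p` and retained (`true`) with probability
`1 - p`, independently. -/
def patternLaw (p : unitInterval) (N : ℕ) : Measure (Pattern N) :=
  Measure.pi fun _ => bernoulliMeasure false true p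

/-- A fair random bit. -/
def fairBit : Measure Bool :=
  bernoulliMeasure true false ⟨1 / 2, by norm_num, by norm_num⟩

/-- A uniformly random binary string of length `N`. -/
def stringLaw (N : ℕ) : Measure (Fin N → Bool) := Measure.pi fun _ => fairBit

/-- A uniformly random binary `N × N` matrix. -/
def matrixLaw (N : ℕ) : Measure (Fin N → Fin N → Bool) := Measure.pi fun _ => stringLaw N

/-- The sample space: an `N × N` matrix with the row and column retention patterns of `m` traces. -/
abbrev Sample (N m : ℕ) := (Fin N → Fin N → Bool) × (Fin m → Pattern N × Pattern N)

/-- A uniformly random matrix, and `m` independent uses of the matrix deletion channel with deletion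
probability `p`. -/
def sampleLaw (p : unitInterval) (N m : ℕ) : Measure (Sample N m) :=
  (matrixLaw N).prod (Measure.pi fun _ => (patternLaw p N).prod (patternLaw p N))

/-- The `m` matrix traces received. -/
def traces {N m : ℕ} (ω : Sample N m) (a : Fin m) : MatrixTrace := matrixTrace ω.1 (ω.2 a)

/-- `log n` where `n = N ^ 2` is the number of entries of an `N × N` matrix. -/
def logSize (N : ℕ) : ℝ := Real.log ((N : ℝ) ^ 2)

/-! ### The median-of-block-sums test

Throughout `q` is the retention probability and `N` is the length of the original string. -/

/-- The block length `w = 100 n^{1/4} √(log n / q)`, rounded up, where `n = N ^ 2`. -/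
def blockLen (q : ℝ) (N : ℕ) : ℕ := ⌈100 * √(N : ℝ) * √(logSize N / q)⌉₊

/-- The number `g = 96 / q ^ 2`, rounded up, of blocks in a group. -/
def groupSize (q : ℝ) : ℕ := ⌈96 / q ^ 2⌉₊

/-- The number of ones of `t` in positions `2wi, …, 2wi + w - 1` (positions beyond the end of `t`
count as zeros). -/
def blockSum (w : ℕ) (t : List Bool) (i : ℕ) : ℤ :=
  ∑ j ∈ Finset.range w, if t.getD (2 * w * i + j) false = true then 1 else 0

/-- `Z_i`, the squared difference of the `i`-th block sums of `t` and `t'`. -/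
def blockSq (w : ℕ) (t t' : List Bool) (i : ℕ) : ℤ := (blockSum w t i - blockSum w t' i) ^ 2

/-- `z_j = ∑_{i < g} Z_{jg + i}`. -/
def groupSum (q : ℝ) (N : ℕ) (t t' : List Bool) (j : ℕ) : ℤ :=
  ∑ i ∈ Finset.range (groupSize q), blockSq (blockLen q N) t t' (j * groupSize q + i)

/-- The median of `2L + 1` numbers: the entry with index `L` after sorting. -/
def median {L : ℕ} (z : Fin (2 * L + 1) → ℤ) : ℤ := z (Tuple.sort z ⟨L, by omega⟩)

/-- `D = median (z_0, …, z_{2L})` with `L = ⌈c log n⌉`. -/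
def medianStat (c q : ℝ) (N : ℕ) (t t' : List Bool) : ℤ :=
  median fun j : Fin (2 * ⌈c * logSize N⌉₊ + 1) => groupSum q N t t' j

/-- The threshold `(1 - q/4) g w / 2`. -/
def threshold (q : ℝ) (N : ℕ) : ℝ := (1 - q / 4) * groupSize q * blockLen q N / 2

/-- The test declares that `t` and `t'` come from the same string. -/
def TestSame (c q : ℝ) (N : ℕ) (t t' : List Bool) : Prop :=
  (medianStat c q N t t' : ℝ) < threshold q N

/-! ### Alignment -/

/-- An assignment of original row and column indices to the rows and columns of the traces. -/
@[ext]
structure Labelling (N : ℕ) {m : ℕ} (T : Fin m → MatrixTrace) where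
  row : (a : Fin m) → Fin (T a).rows ↪o Fin N
  col : (a : Fin m) → Fin (T a).cols ↪o Fin N

/-- The labelling by the true original indices. -/
def trueLabelling {N m : ℕ} (ω : Sample N m) : Labelling N (traces ω) where
  row := fun a => origin (ω.2 a).1
  col := fun a => origin (ω.2 a).2

/-- The labelling agrees with all answers of the median test: two rows (columns) of different traces
get the same label exactly if the test declares them to come from the same row (column). -/
def Labelling.IsAligned {N m : ℕ} {T : Fin m → MatrixTrace} (lab : Labelling N T) (c q : ℝ) :
    Prop :=
  ∀ a b : Fin m, a ≠ b →
    (∀ k l, TestSame c q N ((T a).row k) ((T b).row l) ↔ lab.row a k = lab.row b l) ∧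
    (∀ k l, TestSame c q N ((T a).col k) ((T b).col l) ↔ lab.col a k = lab.col b l)

/-- The matrix `Y` has the received entries at the positions assigned by the labelling. -/
def Labelling.Fits {N m : ℕ} {T : Fin m → MatrixTrace} (lab : Labelling N T)
    (Y : Fin N → Fin N → Bool) : Prop :=
  ∀ a k l, Y (lab.row a k) (lab.col a l) = (T a).entry k l

end MatrixReconstruction

end

open MatrixReconstruction

/-! Fix two retention patterns. A block difference of the two traces is a signed sum of fair bits
over the original positions of the two blocks; for blocks `A`, `B` of size `w`, its square has mean
`(w - |A ∩ B|) / 2`. For unrelated strings there is no overlap and a group of `g` blocks has mean `g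
w / 2`. For traces of one string the patterns drift apart by far less than `w`, so corresponding
blocks share at least `q w / 2` positions (`Regular.card_inter_ge`) and the mean is at most `(1 -
q/2) g w / 2`. The threshold lies halfway, at distance `g q w / 8` from either value.

The gaps of length `w` between consecutive blocks keep the original positions of different blocks
disjoint (`Regular.disjoint_blocks`), so given the patterns the groups are independent. Chebyshev's
inequality bounds the failure probability of one group by `1/3`; the median fails only if `L + 1` of
the `2L + 1` groups fail, which has probability at most `(8/9) ^ L`
(`measureReal_groups_deviate_le`). Hoeffding's inequality makes the patterns regular with
overwhelming probability (`not_regular_le`).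

A union bound makes all row and column tests correct at once. With order `log n` traces, any two
rows, any two columns and any entry survive together in some trace. Correct tests then make any
aligned labelling a relabelling of the true indices by one map, strictly increasing because any two
indices are compared in some trace; such a self-map of `Fin N` is the identity
(`orderEmbedding_eq_origin`). Every entry is received, so the matrix is determined.

Conversely, with at most a small multiple of `log n` traces, some row is lost in all of them with
probability tending to `1` (`no_rowLost_le`). The traces carry no information on its `N` fair bits,
so a guess is right with probability at most `2 ^ (-N)` (`lintegral_guess_le`). -/

/-! ### Moments of sums of independent variables -/

section Moments

variable {Ω ι : Type*} [Finite Ω] [MeasurableSpace Ω] [DiscreteMeasurableSpace Ω]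
  {μ : Measure Ω} [IsProbabilityMeasure μ]

/-- The Gaussian-type bound `E X⁴ ≤ 3 (E X²)²` is stable under independent centred sums: in the
expansion of the fourth power the odd cross terms vanish and `6 E X² E D²` is exactly the cross term
of `3 (E X² + E D²)²`. -/
theorem sum_moments_of_iIndepFun {X : ι → Ω → ℝ} (hX : iIndepFun X μ) (σ : ι → ℝ)
    (h1 : ∀ i, ∫ ω, X i ω ∂μ = 0) (h2 : ∀ i, ∫ ω, X i ω ^ 2 ∂μ = σ i)
    (h4 : ∀ i, ∫ ω, X i ω ^ 4 ∂μ ≤ 3 * σ i ^ 2) (s : Finset ι) :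
    ∫ ω, (∑ i ∈ s, X i ω) ∂μ = 0 ∧ ∫ ω, (∑ i ∈ s, X i ω) ^ 2 ∂μ = ∑ i ∈ s, σ i ∧
      ∫ ω, (∑ i ∈ s, X i ω) ^ 4 ∂μ ≤ 3 * (∑ i ∈ s, σ i) ^ 2 := by
  classical
  induction s using Finset.induction_on with
  | empty => simp
  | insert a s ha ih =>
    obtain ⟨i1, i2, i4⟩ := ih
    have hind : IndepFun (fun ω => ∑ i ∈ s, X i ω) (X a) μ := by
      have := hX.indepFun_finsetSum_of_notMem (fun i => Measurable.of_discrete) ha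
      convert this using 1
      ext ω; simp
    set D : Ω → ℝ := fun ω => ∑ i ∈ s, X i ω with hD
    have hmul : ∀ k l : ℕ, ∫ ω, D ω ^ k * X a ω ^ l ∂μ
        = (∫ ω, D ω ^ k ∂μ) * ∫ ω, X a ω ^ l ∂μ := by
      intro k l
      have h := hind.comp (φ := fun x : ℝ => x ^ k) (ψ := fun x : ℝ => x ^ l)
        (by fun_prop) (by fun_prop)
      exact h.integral_fun_mul_eq_mul_integral Measurable.of_discrete.aestronglyMeasurable
        Measurable.of_discrete.aestronglyMeasurable
    have hint : ∀ f : Ω → ℝ, Integrable f μ := fun f => Integrable.of_finite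
    simp only [Finset.sum_insert ha]
    refine ⟨?_, ?_, ?_⟩
    · rw [integral_add (hint _) (hint _), h1, i1, add_zero]
    · have : ∀ ω, (X a ω + D ω) ^ 2 = X a ω ^ 2 + 2 * (D ω ^ 1 * X a ω ^ 1) + D ω ^ 2 := by
        intro ω; ring
      change ∫ ω, (X a ω + D ω) ^ 2 ∂μ = _
      simp only [this]
      rw [integral_add (hint _) (hint _), integral_add (hint _) (hint _), integral_const_mul,
        hmul, h2, i2]
      simp [h1]
    · have : ∀ ω, (X a ω + D ω) ^ 4 = X a ω ^ 4 + 4 * (D ω ^ 1 * X a ω ^ 3)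
          + 6 * (D ω ^ 2 * X a ω ^ 2) + 4 * (D ω ^ 3 * X a ω ^ 1) + D ω ^ 4 := by
        intro ω; ring
      change ∫ ω, (X a ω + D ω) ^ 4 ∂μ ≤ _
      simp only [this]
      rw [integral_add (hint _) (hint _), integral_add (hint _) (hint _),
        integral_add (hint _) (hint _), integral_add (hint _) (hint _), integral_const_mul,
        integral_const_mul, integral_const_mul, hmul, hmul, hmul, h2, i2]
      simp only [pow_one, h1, i1]
      nlinarith [h4 a]

/-- Chebyshev's inequality: the fourth moment bound gives `Var (Y i ²) ≤ 3 τ² - τ² = 2 τ²`. -/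
theorem measureReal_sum_sq_deviation_le {J : Type*} [Fintype J] {Y : J → Ω → ℝ}
    (hY : iIndepFun Y μ) {τ : J → ℝ} {T : ℝ} (h2 : ∀ i, ∫ ω, Y i ω ^ 2 ∂μ = τ i)
    (h4 : ∀ i, ∫ ω, Y i ω ^ 4 ∂μ ≤ 3 * τ i ^ 2) (hτ : ∀ i, τ i ≤ T) {c : ℝ} (hc : 0 < c) :
    μ.real {ω | c ≤ |∑ i, Y i ω ^ 2 - ∑ i, τ i|} ≤ 2 * Fintype.card J * T ^ 2 / c ^ 2 := by
  have hint : ∀ f : Ω → ℝ, Integrable f μ := fun f => Integrable.of_finite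
  have hLp : ∀ f : Ω → ℝ, MemLp f 2 μ := fun f => MemLp.of_discrete
  have hind : iIndepFun (fun i ω => Y i ω ^ 2) μ :=
    hY.comp (fun _ x => x ^ 2) (fun _ => by fun_prop)
  have hmean : ∫ ω, ∑ i, Y i ω ^ 2 ∂μ = ∑ i, τ i := by
    rw [integral_finsetSum _ fun i _ => hint _]
    simp [h2]
  have hvar : variance (fun ω => ∑ i, Y i ω ^ 2) μ ≤ 2 * Fintype.card J * T ^ 2 := by
    have h : variance (∑ i, fun ω => Y i ω ^ 2) μ = ∑ i, variance (fun ω => Y i ω ^ 2) μ :=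
      IndepFun.variance_sum (fun i _ => hLp _) fun i _ j _ hij => hind.indepFun hij
    have e : (∑ i, fun ω => Y i ω ^ 2) = fun ω => ∑ i, Y i ω ^ 2 := by ext ω; simp
    rw [← e, h]
    calc _ ≤ ∑ _i : J, 2 * T ^ 2 := by
          refine Finset.sum_le_sum fun i _ => ?_
          rw [variance_eq_sub (hLp _)]
          have h0 : 0 ≤ τ i := by rw [← h2]; exact integral_nonneg fun ω => sq_nonneg _
          have e4 : ∫ ω, ((fun ω => Y i ω ^ 2) ^ 2) ω ∂μ = ∫ ω, Y i ω ^ 4 ∂μ := by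
            congr 1; ext ω; simp only [Pi.pow_apply]; ring
          rw [e4, h2]
          nlinarith [h4 i, hτ i]
      _ = _ := by simp; ring
  have hch := meas_ge_le_variance_div_sq (hLp fun ω => ∑ i, Y i ω ^ 2) (μ := μ) hc
  rw [hmean] at hch
  refine (ENNReal.toReal_mono ENNReal.ofReal_ne_top hch).trans ?_
  rw [ENNReal.toReal_ofReal (div_nonneg (variance_nonneg _ _) (sq_nonneg _))]
  gcongr

/-- Of `2L + 1` independent events of probability at most `1/3`, a majority occurs with
exponentially small probability. -/
theorem measureReal_majority_le {L : ℕ} {β : Type*} [MeasurableSpace β]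
    {W : Fin (2 * L + 1) → Ω → β} (hW : iIndepFun W μ) {B : Fin (2 * L + 1) → Set β}
    (hB : ∀ j, MeasurableSet (B j)) (h : ∀ j, μ.real {ω | W j ω ∈ B j} ≤ 1 / 3) :
    μ.real {ω | L + 1 ≤ Nat.card {j | W j ω ∈ B j}} ≤ (8 / 9) ^ L := by
  classical
  have hint : ∀ f : Ω → ℝ, Integrable f μ := fun f => Integrable.of_finite
  -- Exponential Markov inequality with base `2`: the product of these weights is `2` to the number
  -- of events that occur, and its mean is at most `(4/3) ^ (2L + 1)`. Dividing by `2 ^ (L + 1)`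
  -- leaves `(2/3) (8/9) ^ L`.
  let φ : Fin (2 * L + 1) → β → ℝ := fun j b => 1 + (B j).indicator (fun _ => 1) b
  have hφ : iIndepFun (fun j ω => φ j (W j ω)) μ :=
    hW.comp φ fun j => (measurable_const.indicator (hB j)).const_add 1
  have hprod := hφ.integral_fun_prod_eq_prod_integral
    (fun j => Measurable.of_discrete.aestronglyMeasurable)
  have hj : ∀ j, ∫ ω, φ j (W j ω) ∂μ ≤ 4 / 3 := by
    intro j
    have e : ∀ ω, φ j (W j ω) = 1 + {ω | W j ω ∈ B j}.indicator (fun _ => (1 : ℝ)) ω := by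
      intro ω; simp [φ, Set.indicator]
    simp only [e]
    rw [integral_add (hint _) (hint _), integral_indicator (MeasurableSet.of_discrete)]
    simp only [integral_const, smul_eq_mul, mul_one, probReal_univ,
      measureReal_restrict_apply MeasurableSet.univ, Set.univ_inter]
    linarith [h j]
  have h0 : ∀ j ω, 0 ≤ φ j (W j ω) := fun j ω =>
    add_nonneg zero_le_one (Set.indicator_nonneg (fun _ _ => zero_le_one) _)
  have hmark : (2 : ℝ) ^ (L + 1) * μ.real {ω | L + 1 ≤ Nat.card {j | W j ω ∈ B j}}
      ≤ ∫ ω, ∏ j, φ j (W j ω) ∂μ := by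
    refine le_trans ?_ (mul_meas_ge_le_integral_of_nonneg
      (ae_of_all _ fun ω => Finset.prod_nonneg fun j _ => h0 j ω) (hint _) (2 ^ (L + 1)))
    gcongr
    · exact measure_ne_top _ _
    rename_i ω
    intro hω
    have e : ∏ j, φ j (W j ω) = 2 ^ (Nat.card {j | W j ω ∈ B j}) := by
      have : ∀ j, φ j (W j ω) = if W j ω ∈ B j then 2 else 1 := by
        intro j; by_cases hb : W j ω ∈ B j <;> simp [φ, hb]; norm_num
      simp only [this]
      rw [Finset.prod_ite]
      simp [Nat.card_eq_fintype_card, Fintype.card_subtype]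
    simp only [e] at hω ⊢
    exact pow_le_pow_right₀ (by norm_num) hω
  rw [hprod] at hmark
  have h3 : ∏ j, ∫ ω, φ j (W j ω) ∂μ ≤ (4 / 3) ^ (2 * L + 1) := by
    calc _ ≤ ∏ _j : Fin (2 * L + 1), (4 / 3 : ℝ) :=
          Finset.prod_le_prod (fun j _ => integral_nonneg fun ω => h0 j ω) fun j _ => hj j
      _ = _ := by rw [Finset.prod_const, Finset.card_univ, Fintype.card_fin]
  have h4 : (2 : ℝ) ^ (L + 1) * μ.real {ω | L + 1 ≤ Nat.card {j | W j ω ∈ B j}}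
      ≤ (2 : ℝ) ^ (L + 1) * ((2 / 3) * (8 / 9) ^ L) := by
    refine (hmark.trans h3).trans (le_of_eq ?_)
    rw [pow_succ (4 / 3 : ℝ), pow_mul, pow_succ (2 : ℝ),
      show (2 : ℝ) ^ L * 2 * (2 / 3 * (8 / 9) ^ L) = (4 / 3) * (2 ^ L * (8 / 9) ^ L) by ring,
      ← mul_pow]
    norm_num; ring
  have h5 := le_of_mul_le_mul_left h4 (by positivity)
  have : (0 : ℝ) < (8 / 9) ^ L := by positivity
  linarith

end Moments

/-! ### Signed sums of fair bits -/

/-- A centred fair bit. -/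
noncomputable def centred (b : Bool) : ℝ := if b then 1 / 2 else -(1 / 2)

instance : IsProbabilityMeasure fairBit := by unfold fairBit; infer_instance

theorem integral_fairBit (f : Bool → ℝ) : ∫ b, f b ∂fairBit = (f true + f false) / 2 := by
  rw [fairBit, integral_bernoulliMeasure]; simp; ring

section SignedSums

variable {V : Type*} [Fintype V]

theorem iIndepFun_eval_fairBit :
    iIndepFun (fun (v : V) (x : V → Bool) => x v) (Measure.pi fun _ : V => fairBit) :=
  iIndepFun_pi (X := fun _ b => b) fun _ => aemeasurable_id

theorem integral_eval_fairBit (v : V) (f : Bool → ℝ) :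
    ∫ x : V → Bool, f (x v) ∂(Measure.pi fun _ : V => fairBit) = (f true + f false) / 2 := by
  rw [← integral_fairBit]
  exact integral_comp_eval (μ := fun _ : V => fairBit) (i := v)
    Measurable.of_discrete.aestronglyMeasurable

omit [Fintype V] in
theorem iIndepFun_restrict_of_pairwise_disjoint {Ω K β : Type*} [MeasurableSpace Ω]
    [MeasurableSpace β] {μ : Measure Ω} {X : V → Ω → β} (hX : iIndepFun X μ)
    (hm : ∀ v, Measurable (X v)) {F : K → Finset V}
    (hF : ∀ k l, k ≠ l → Disjoint (F k) (F l)) :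
    iIndepFun (fun k ω (v : F k) => X v ω) μ := by
  classical
  have := hX.isProbabilityMeasure
  rw [iIndepFun_iff_measure_inter_preimage_eq_mul]
  intro S sets hsets
  induction S using Finset.induction_on with
  | empty => simp
  | insert a S ha ih =>
    rw [Finset.prod_insert ha, Finset.set_biInter_insert,
      ← ih fun i hi => hsets i (Finset.mem_insert_of_mem hi)]
    have hd : Disjoint (F a) (S.biUnion F) := by
      rw [Finset.disjoint_biUnion_right]
      exact fun i hi => hF a i fun h => ha (h ▸ hi)
    have hind := hX.indepFun_finset (F a) (S.biUnion F) hd hm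
    let E : Set (S.biUnion F → β) := ⋂ j : S,
      (fun y (v : F j) => y ⟨v, Finset.mem_biUnion.2 ⟨j, j.2, v.2⟩⟩) ⁻¹' sets j
    have hE : MeasurableSet E := MeasurableSet.iInter fun j =>
      (measurable_pi_lambda _ fun v => measurable_pi_apply _)
        (hsets j (Finset.mem_insert_of_mem j.2))
    have h := hind.measure_inter_preimage_eq_mul (sets a) E
      (hsets a (Finset.mem_insert_self _ _)) hE
    have e : (fun ω (v : S.biUnion F) => X v ω) ⁻¹' E
        = ⋂ i ∈ S, (fun ω (v : F i) => X v ω) ⁻¹' sets i := by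
      ext ω; simp [E]
    rw [e] at h
    exact h

theorem iIndepFun_of_dependsOn_disjoint {K β : Type*} [MeasurableSpace β]
    {f : K → (V → Bool) → β} {F : K → Finset V} (hF : ∀ k l, k ≠ l → Disjoint (F k) (F l))
    (hf : ∀ k x y, (∀ v ∈ F k, x v = y v) → f k x = f k y) :
    iIndepFun f (Measure.pi fun _ : V => fairBit) := by
  classical
  have h := (iIndepFun_restrict_of_pairwise_disjoint iIndepFun_eval_fairBit
    (fun v => Measurable.of_discrete) hF).comp
    -- The default `false` off `F k` is harmless, since `f k` reads only the coordinates in `F k`.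
    (fun k y => f k fun v => if h : v ∈ F k then y ⟨v, h⟩ else false)
    fun k => Measurable.of_discrete
  convert h using 1
  ext k x
  refine hf k _ _ fun v hv => ?_
  simp [hv]

variable [DecidableEq V]

/-- The difference of the numbers of ones of `x` in `A` and in `B`. -/
def signedSum (A B : Finset V) (x : V → Bool) : ℤ :=
  (∑ v ∈ A, if x v = true then 1 else 0) - ∑ v ∈ B, if x v = true then 1 else 0

/-- The contribution of the position `v` to a balanced signed sum. -/
noncomputable def signedTerm (A B : Finset V) (v : V) (b : Bool) : ℝ :=
  ((if v ∈ A then 1 else 0) - (if v ∈ B then 1 else 0)) * centred b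

omit [Fintype V] in
theorem signedSum_eq {A B : Finset V} (h : A.card = B.card) (x : V → Bool) :
    (signedSum A B x : ℝ) = ∑ v ∈ A ∪ B, signedTerm A B v (x v) := by
  have e : ∀ b : Bool, ((if b = true then (1 : ℤ) else 0 : ℤ) : ℝ) = centred b + 1 / 2 := by
    intro b; cases b <;> norm_num [centred]
  have hA : ∑ v ∈ A ∪ B, (if v ∈ A then (1 : ℝ) else 0) * centred (x v)
      = ∑ v ∈ A, centred (x v) := by
    simp only [ite_mul, one_mul, zero_mul, ← Finset.sum_filter]
    refine Finset.sum_congr ?_ fun _ _ => rfl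
    ext v; simp +contextual
  have hB : ∑ v ∈ A ∪ B, (if v ∈ B then (1 : ℝ) else 0) * centred (x v)
      = ∑ v ∈ B, centred (x v) := by
    simp only [ite_mul, one_mul, zero_mul, ← Finset.sum_filter]
    refine Finset.sum_congr ?_ fun _ _ => rfl
    ext v; simp +contextual
  simp only [signedTerm, sub_mul, Finset.sum_sub_distrib, hA, hB]
  simp only [signedSum, Int.cast_sub, Int.cast_sum, e, Finset.sum_add_distrib, Finset.sum_const, h]
  ring

/-- Positions of `A ∩ B` cancel and every other position of `A ∪ B` contributes a centred bit of
variance `1/4`, up to sign. There are `2 (|A| - |A ∩ B|)` of these. -/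
theorem signedSum_moments {A B : Finset V} (h : A.card = B.card) :
    ∫ x, (signedSum A B x : ℝ) ^ 2 ∂(Measure.pi fun _ : V => fairBit)
      = ((A.card : ℝ) - (A ∩ B).card) / 2 ∧
    ∫ x, (signedSum A B x : ℝ) ^ 4 ∂(Measure.pi fun _ : V => fairBit)
      ≤ 3 * (((A.card : ℝ) - (A ∩ B).card) / 2) ^ 2 := by
  have hind : iIndepFun (fun (v : V) (x : V → Bool) => signedTerm A B v (x v))
      (Measure.pi fun _ : V => fairBit) :=
    iIndepFun_eval_fairBit.comp (fun v => signedTerm A B v) fun v => Measurable.of_discrete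
  obtain ⟨-, m2, m4⟩ := sum_moments_of_iIndepFun hind
    (fun v => ((if v ∈ A then 1 else 0) - (if v ∈ B then 1 else 0)) ^ 2 / 4)
    (fun v => by rw [integral_eval_fairBit]; simp [signedTerm, centred])
    (fun v => by
      rw [integral_eval_fairBit v fun b => signedTerm A B v b ^ 2]
      simp [signedTerm, centred]; ring)
    (fun v => by
      rw [integral_eval_fairBit v fun b => signedTerm A B v b ^ 4]
      simp only [signedTerm, centred]
      split_ifs <;> norm_num) (A ∪ B)
  have hs : ∑ v ∈ A ∪ B, ((if v ∈ A then (1 : ℝ) else 0) - (if v ∈ B then 1 else 0)) ^ 2 / 4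
      = ((A.card : ℝ) - (A ∩ B).card) / 2 := by
    have e : ∀ v ∈ A ∪ B, ((if v ∈ A then (1 : ℝ) else 0) - (if v ∈ B then 1 else 0)) ^ 2 / 4
        = (1 - if v ∈ A ∩ B then 1 else 0) / 4 := by
      intro v hv
      by_cases ha : v ∈ A <;> by_cases hb : v ∈ B <;> simp_all
    rw [Finset.sum_congr rfl e, ← Finset.sum_div, Finset.sum_sub_distrib,
      ← Finset.sum_filter]
    have : (A ∪ B).filter (· ∈ A ∩ B) = A ∩ B := by ext v; simp; tauto
    have hc := Finset.card_union_add_card_inter A B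
    have hc' : ((A ∪ B).card : ℝ) + (A ∩ B).card = A.card + A.card := by
      rw [h] at hc ⊢; exact_mod_cast hc
    rw [this]; simp only [Finset.sum_const, nsmul_eq_mul, mul_one]
    linarith
  simp only [signedSum_eq h]
  rw [hs] at m2 m4
  exact ⟨m2, m4⟩

/-- Concentration, for a majority of the groups, of sums of squares of balanced signed sums over
disjoint sets of positions. -/
theorem measureReal_groups_deviate_le {L g : ℕ} {w q : ℝ} (hg : 96 ≤ g * q ^ 2) (hq : 0 < q)
    (hw : 0 < w) (A B : Fin (2 * L + 1) → Fin g → Finset V)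
    (hA : ∀ j i, ((A j i).card : ℝ) = w) (hAB : ∀ j i, (A j i).card = (B j i).card)
    (hdisj : ∀ k l : Fin (2 * L + 1) × Fin g, k ≠ l →
      Disjoint (A k.1 k.2 ∪ B k.1 k.2) (A l.1 l.2 ∪ B l.1 l.2)) :
    (Measure.pi fun _ : V => fairBit).real {x | L + 1 ≤ Nat.card {j | g * q * w / 8 ≤
      |∑ i, (signedSum (A j i) (B j i) x : ℝ) ^ 2
        - ∑ i, (w - (A j i ∩ B j i).card) / 2|}} ≤ (8 / 9) ^ L := by
  have hdep : ∀ j i (x y : V → Bool), (∀ v ∈ A j i ∪ B j i, x v = y v) →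
      signedSum (A j i) (B j i) x = signedSum (A j i) (B j i) y := by
    intro j i x y h
    unfold signedSum
    congr 1 <;> refine Finset.sum_congr rfl fun v hv => ?_
    · rw [h v (Finset.mem_union_left _ hv)]
    · rw [h v (Finset.mem_union_right _ hv)]
  have hindep : iIndepFun (fun j x => ∑ i, (signedSum (A j i) (B j i) x : ℝ) ^ 2
      - ∑ i, (w - (A j i ∩ B j i).card) / 2) (Measure.pi fun _ : V => fairBit) := by
    refine iIndepFun_of_dependsOn_disjoint
      (F := fun j => Finset.univ.biUnion fun i => A j i ∪ B j i) (fun j l hjl => ?_)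
      fun j x y h => ?_
    · rw [Finset.disjoint_biUnion_left]
      refine fun i _ => ?_
      rw [Finset.disjoint_biUnion_right]
      exact fun i' _ => hdisj (j, i) (l, i') fun e => hjl (congrArg Prod.fst e)
    · congr 1
      refine Finset.sum_congr rfl fun i _ => ?_
      rw [hdep j i x y fun v hv => h v (Finset.mem_biUnion.2 ⟨i, Finset.mem_univ _, hv⟩)]
  have hg0 : 0 < (g : ℝ) := by
    by_contra hcon
    nlinarith [mul_nonneg (sub_nonneg.2 (not_lt.1 hcon)) (sq_nonneg q)]
  refine measureReal_majority_le (B := fun _ => {r : ℝ | g * q * w / 8 ≤ |r|}) hindep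
    (fun j => measurableSet_le measurable_const (by fun_prop)) fun j => ?_
  have hY : iIndepFun (fun i (x : V → Bool) => (signedSum (A j i) (B j i) x : ℝ))
      (Measure.pi fun _ : V => fairBit) := by
    refine iIndepFun_of_dependsOn_disjoint (F := fun i => A j i ∪ B j i)
      (fun i l hil => hdisj (j, i) (j, l) fun e => hil (congrArg Prod.snd e)) fun i x y h => ?_
    rw [hdep j i x y h]
  have hmom := fun i => signedSum_moments (hAB j i)
  simp only [hA] at hmom
  -- Chebyshev gives `2 g (w/2)² / (g q w / 8)² = 32 / (g q²)`, which is at most `1/3` exactly when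
  -- `g q² ≥ 96`; hence the group size.
  refine (measureReal_sum_sq_deviation_le hY (T := w / 2) (fun i => (hmom i).1)
    (fun i => (hmom i).2) (fun i => ?_) (c := g * q * w / 8) (by positivity)).trans ?_
  · have : (0 : ℝ) ≤ (A j i ∩ B j i).card := Nat.cast_nonneg _
    linarith
  · rw [div_le_div_iff₀ (by positivity) (by norm_num), Fintype.card_fin]
    have : 0 ≤ (g * w ^ 2) * (g * q ^ 2 - 96) := mul_nonneg (by positivity) (by linarith)
    nlinarith

end SignedSums

/-! ### The median -/

/-- Together with `card_of_le_median`, this turns an error of the median into a majority event for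
the groups. -/
theorem card_of_median_lt {L : ℕ} {z : Fin (2 * L + 1) → ℤ} {r : ℝ} (h : (median z : ℝ) < r) :
    L + 1 ≤ Nat.card {j | (z j : ℝ) < r} := by
  classical
  let m : Fin (2 * L + 1) := ⟨L, by omega⟩
  have hsub : (Finset.Iic m).map (Tuple.sort z).toEmbedding
      ⊆ Finset.univ.filter fun j => (z j : ℝ) < r := by
    intro j hj
    obtain ⟨i, hi, rfl⟩ := Finset.mem_map.1 hj
    have : z (Tuple.sort z i) ≤ z (Tuple.sort z m) := Tuple.monotone_sort z (Finset.mem_Iic.1 hi)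
    simp only [Finset.mem_filter, Finset.mem_univ, true_and]
    refine lt_of_le_of_lt ?_ h
    exact_mod_cast this
  have := Finset.card_le_card hsub
  rw [Finset.card_map, Fin.card_Iic] at this
  rw [Nat.card_eq_fintype_card, Fintype.card_subtype]
  exact this

theorem card_of_le_median {L : ℕ} {z : Fin (2 * L + 1) → ℤ} {r : ℝ} (h : r ≤ (median z : ℝ)) :
    L + 1 ≤ Nat.card {j | r ≤ (z j : ℝ)} := by
  classical
  let m : Fin (2 * L + 1) := ⟨L, by omega⟩
  have hsub : (Finset.Ici m).map (Tuple.sort z).toEmbedding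
      ⊆ Finset.univ.filter fun j => r ≤ (z j : ℝ) := by
    intro j hj
    obtain ⟨i, hi, rfl⟩ := Finset.mem_map.1 hj
    have : z (Tuple.sort z m) ≤ z (Tuple.sort z i) := Tuple.monotone_sort z (Finset.mem_Ici.1 hi)
    simp only [Finset.mem_filter, Finset.mem_univ, true_and]
    refine h.trans ?_
    exact_mod_cast this
  have := Finset.card_le_card hsub
  rw [Finset.card_map, Fin.card_Ici] at this
  rw [Nat.card_eq_fintype_card, Fintype.card_subtype]
  have e : 2 * L + 1 - (m : ℕ) = L + 1 := by simp only [m]; omega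
  rw [e] at this
  exact this

/-! ### Blocks of retained positions -/

section Blocks

variable {N : ℕ}

/-- The number of retained positions below `u`. -/
def keptBelow (κ : Pattern N) (u : ℕ) : ℕ := ((kept κ).filter fun v : Fin N => (v : ℕ) < u).card

theorem keptBelow_mono (κ : Pattern N) : Monotone (keptBelow κ) := fun _ _ h =>
  Finset.card_le_card (Finset.monotone_filter_right _ fun _ _ hv => lt_of_lt_of_le hv h)

theorem keptBelow_le_card (κ : Pattern N) (u : ℕ) : keptBelow κ u ≤ (kept κ).card :=
  Finset.card_filter_le _ _

/-- `keptBelow` recovers the index in the trace from the original position, so membership in a block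
becomes an inequality for a counting function. -/
theorem keptBelow_origin (κ : Pattern N) (k : Fin (kept κ).card) :
    keptBelow κ (origin κ k) = k := by
  have : (kept κ).filter (fun v : Fin N => (v : ℕ) < origin κ k)
      = (Finset.Iio k).map (origin κ).toEmbedding := by
    ext v
    simp only [Finset.mem_filter, Finset.mem_map, Finset.mem_Iio]
    constructor
    · rintro ⟨hv, hlt⟩
      have : v ∈ Set.range (origin κ) := by
        rw [origin, Finset.range_orderEmbOfFin]; exact hv
      obtain ⟨l, rfl⟩ := this
      exact ⟨l, (origin κ).lt_iff_lt.1 hlt, rfl⟩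
    · rintro ⟨l, hl, rfl⟩
      exact ⟨Finset.orderEmbOfFin_mem _ _ _, (origin κ).lt_iff_lt.2 hl⟩
  rw [keptBelow, this, Finset.card_map, Fin.card_Iio]

theorem mem_kept_iff {κ : Pattern N} {v : Fin N} : v ∈ kept κ ↔ κ v = true := by
  simp [kept]

theorem exists_origin_eq {κ : Pattern N} {v : Fin N} (h : κ v = true) :
    ∃ k, origin κ k = v := by
  have : v ∈ Set.range (origin κ) := by
    rw [origin, Finset.range_orderEmbOfFin]; exact mem_kept_iff.2 h
  exact this

/-- The original positions of the `k`-th block of length `w` of a trace. -/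
def originBlock (κ : Pattern N) (w k : ℕ) : Finset (Fin N) :=
  (kept κ).filter fun v => 2 * w * k ≤ keptBelow κ v ∧ keptBelow κ v < 2 * w * k + w

/-- Summation along a trace block is transported to original positions. General summands allow both
the block sum and the block size to be read off. -/
theorem sum_originBlock {κ : Pattern N} {w k : ℕ} (h : 2 * w * k + w ≤ (kept κ).card)
    {F : ℕ → ℤ} {G : Fin N → ℤ} (hFG : ∀ i : Fin (kept κ).card, F i = G (origin κ i)) :
    ∑ j ∈ Finset.range w, F (2 * w * k + j) = ∑ v ∈ originBlock κ w k, G v := by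
  refine Finset.sum_bij (fun j hj => origin κ ⟨2 * w * k + j, by
    have := Finset.mem_range.1 hj; omega⟩) ?_ ?_ ?_ ?_
  · intro j hj
    have := Finset.mem_range.1 hj
    rw [originBlock, Finset.mem_filter, keptBelow_origin]
    refine ⟨Finset.orderEmbOfFin_mem _ _ _, ?_, ?_⟩ <;> simp only <;> omega
  · intro a ha b hb hab
    have := (origin κ).injective hab
    simpa using this
  · intro v hv
    obtain ⟨hv, h1, h2⟩ := Finset.mem_filter.1 hv
    obtain ⟨i, rfl⟩ := exists_origin_eq (mem_kept_iff.1 hv)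
    rw [keptBelow_origin] at h1 h2
    refine ⟨i - 2 * w * k, Finset.mem_range.2 (by omega), ?_⟩
    congr 1
    ext
    simp only
    omega
  · intro j hj
    exact hFG ⟨2 * w * k + j, _⟩

theorem card_originBlock {κ : Pattern N} {w k : ℕ} (h : 2 * w * k + w ≤ (kept κ).card) :
    (originBlock κ w k).card = w := by
  have := sum_originBlock h (F := fun _ => 1) (G := fun _ => 1) fun _ => rfl
  simpa using this.symm

theorem blockSum_stringTrace (x : Fin N → Bool) {κ : Pattern N} {w k : ℕ}
    (h : 2 * w * k + w ≤ (kept κ).card) :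
    blockSum w (stringTrace x κ) k = ∑ v ∈ originBlock κ w k, if x v = true then 1 else 0 := by
  refine sum_originBlock h (F := fun j => if (stringTrace x κ).getD j false = true then 1 else 0)
    fun i => ?_
  simp [stringTrace]

theorem blockSq_same (x : Fin N → Bool) {κ κ' : Pattern N} {w k : ℕ}
    (h : 2 * w * k + w ≤ (kept κ).card) (h' : 2 * w * k + w ≤ (kept κ').card) :
    blockSq w (stringTrace x κ) (stringTrace x κ') k
      = signedSum (originBlock κ w k) (originBlock κ' w k) x ^ 2 := by
  rw [blockSq, blockSum_stringTrace x h, blockSum_stringTrace x h', signedSum]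

/-- Two independent strings are treated as one string indexed by `Fin N ⊕ Fin N`, so that the
estimates for signed sums apply to two sets that never meet. -/
theorem blockSq_indep (x y : Fin N → Bool) {κ κ' : Pattern N} {w k : ℕ}
    (h : 2 * w * k + w ≤ (kept κ).card) (h' : 2 * w * k + w ≤ (kept κ').card) :
    blockSq w (stringTrace x κ) (stringTrace y κ') k
      = signedSum ((originBlock κ w k).map ⟨Sum.inl, Sum.inl_injective⟩)
          ((originBlock κ' w k).map ⟨Sum.inr, Sum.inr_injective⟩) (Sum.elim x y) ^ 2 := by
  rw [blockSq, blockSum_stringTrace x h, blockSum_stringTrace y h', signedSum, Finset.sum_map,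
    Finset.sum_map]
  simp only [Function.Embedding.coeFn_mk, Sum.elim_inl, Sum.elim_inr]
  rfl

/-! ### Regular pairs of patterns -/

/-- The number of positions below `u` retained by both patterns. -/
def keptBoth (κ κ' : Pattern N) (u : ℕ) : ℕ :=
  ((kept κ ∩ kept κ').filter fun v : Fin N => (v : ℕ) < u).card

/-- The numbers of retained positions below `u`, for all `u ≤ U`, are close to their means. -/
structure Regular (q Δ : ℝ) (U : ℕ) (κ κ' : Pattern N) : Prop where
  left : ∀ u ≤ U, |(keptBelow κ u : ℝ) - q * u| ≤ Δ
  right : ∀ u ≤ U, |(keptBelow κ' u : ℝ) - q * u| ≤ Δ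
  both : ∀ u ≤ U, |(keptBoth κ κ' u : ℝ) - q ^ 2 * u| ≤ 2 * Δ

variable {q Δ : ℝ} {U : ℕ} {κ κ' : Pattern N} {w K : ℕ}

theorem Regular.symm (h : Regular q Δ U κ κ') : Regular q Δ U κ' κ :=
  ⟨h.right, h.left, by simpa only [keptBoth, Finset.inter_comm] using h.both⟩

theorem Regular.le_keptBelow (h : Regular q Δ U κ κ') (hK : (2 * w * K : ℝ) ≤ q * U - Δ) :
    2 * w * K ≤ keptBelow κ U := by
  have := (abs_le.1 (h.left U le_rfl)).1
  have h2 : (2 * w * K : ℝ) ≤ keptBelow κ U := by linarith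
  exact_mod_cast h2

theorem Regular.block_le_card (h : Regular q Δ U κ κ') (hK : (2 * w * K : ℝ) ≤ q * U - Δ) {k : ℕ}
    (hk : k < K) : 2 * w * k + w ≤ (kept κ).card := by
  refine le_trans ?_ ((h.le_keptBelow hK).trans (keptBelow_le_card _ _))
  calc 2 * w * k + w ≤ 2 * w * (k + 1) := by rw [mul_add]; omega
    _ ≤ 2 * w * K := Nat.mul_le_mul_left _ hk

theorem Regular.lt_of_mem_originBlock (h : Regular q Δ U κ κ')
    (hK : (2 * w * K : ℝ) ≤ q * U - Δ) {k : ℕ} (hk : k < K) {v : Fin N}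
    (hv : v ∈ originBlock κ w k) : (v : ℕ) < U ∧ 2 * w * k - Δ ≤ q * (v : ℕ) ∧
      q * (v : ℕ) < 2 * w * k + w + Δ := by
  obtain ⟨-, h1, h2⟩ := Finset.mem_filter.1 hv
  have hU : (v : ℕ) < U := by
    by_contra hcon
    have := keptBelow_mono κ (not_lt.1 hcon)
    have h3 := h.le_keptBelow hK
    have : 2 * w * k + w ≤ 2 * w * K := by
      calc 2 * w * k + w ≤ 2 * w * (k + 1) := by rw [mul_add]; omega
        _ ≤ 2 * w * K := Nat.mul_le_mul_left _ hk
    omega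
  have := abs_le.1 (h.left v hU.le)
  have h1' : (2 * w * k : ℝ) ≤ keptBelow κ v := by exact_mod_cast h1
  have h2' : (keptBelow κ v : ℝ) < 2 * w * k + w := by exact_mod_cast h2
  exact ⟨hU, by linarith, by linarith⟩

/-- Scaled by `q`, the positions of block `k` lie in `[2wk - Δ, 2wk + w + Δ)`. Successive windows
are separated because the gap `w` exceeds `2Δ`. -/
theorem Regular.disjoint_blocks (h : Regular q Δ U κ κ') (hK : (2 * w * K : ℝ) ≤ q * U - Δ)
    (hΔ : 2 * Δ < w) {k l : ℕ} (hk : k < K) (hl : l < K) (hkl : k ≠ l) :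
    Disjoint (originBlock κ w k ∪ originBlock κ' w k)
      (originBlock κ w l ∪ originBlock κ' w l) := by
  wlog hlt : k < l generalizing k l
  · exact (this hl hk hkl.symm (by omega)).symm
  have key : ∀ m < K, ∀ v ∈ originBlock κ w m ∪ originBlock κ' w m,
      2 * w * m - Δ ≤ q * (v : ℕ) ∧ q * (v : ℕ) < 2 * w * m + w + Δ := by
    intro m hm v hv
    rcases Finset.mem_union.1 hv with hv | hv
    · exact (h.lt_of_mem_originBlock hK hm hv).2
    · exact (h.symm.lt_of_mem_originBlock hK hm hv).2
  rw [Finset.disjoint_left]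
  intro v hv hv'
  have h1 := (key k hk v hv).2
  have h2 := (key l hl v hv').1
  have h3 : (2 * w * k + 2 * w : ℝ) ≤ 2 * w * l := by
    have : 2 * w * (k + 1) ≤ 2 * w * l := Nat.mul_le_mul_left _ hlt
    have : ((2 * w * (k + 1) : ℕ) : ℝ) ≤ ((2 * w * l : ℕ) : ℝ) := by exact_mod_cast this
    push_cast at this; linarith
  linarith

/-- A position `v` kept by both patterns with `2wk + Δ ≤ q v < 2wk + w - Δ` belongs to both blocks
whatever the drift. Such `v` are counted by a difference of two values of `keptBoth`. -/
theorem Regular.card_inter_ge (h : Regular q Δ U κ κ') (hK : (2 * w * K : ℝ) ≤ q * U - Δ)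
    (hq : 0 < q) (hq1 : q ≤ 1) (hΔ : Δ = q * w / 20) (hw : 5 ≤ q * w) {k : ℕ} (hk : k < K) :
    q * w / 2 ≤ (originBlock κ w k ∩ originBlock κ' w k).card := by
  set a := ⌈(2 * w * k + Δ) / q⌉₊ with ha
  set b := ⌈(2 * w * k + w - Δ) / q⌉₊ with hb
  have hkK : (2 * w * k + 2 * w : ℝ) ≤ 2 * w * K := by
    have : 2 * w * (k + 1) ≤ 2 * w * K := Nat.mul_le_mul_left _ hk
    have : ((2 * w * (k + 1) : ℕ) : ℝ) ≤ ((2 * w * K : ℕ) : ℝ) := by exact_mod_cast this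
    push_cast at this; linarith
  have hw0 : (0 : ℝ) ≤ w := Nat.cast_nonneg _
  have hwq : q * w ≤ w := by nlinarith
  have hbU : b ≤ U := by
    refine Nat.ceil_le.2 ?_
    rw [div_le_iff₀ hq]; nlinarith
  have hab : a ≤ b := Nat.ceil_mono (by gcongr ?_ / q; linarith)
  have hb' : (2 * w * k + w - Δ) / q ≤ b := Nat.le_ceil _
  have ha' : (a : ℝ) < (2 * w * k + Δ) / q + 1 := Nat.ceil_lt_add_one (by
    have : (0 : ℝ) ≤ k := Nat.cast_nonneg _
    have : 0 ≤ Δ := by rw [hΔ]; positivity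
    positivity)
  have hsub : (kept κ ∩ kept κ').filter (fun v : Fin N => a ≤ (v : ℕ) ∧ (v : ℕ) < b)
      ⊆ originBlock κ w k ∩ originBlock κ' w k := by
    intro v hv
    obtain ⟨hv, hav, hvb⟩ := Finset.mem_filter.1 hv
    have h1 : 2 * w * k + Δ ≤ q * (v : ℕ) := by
      have := Nat.ceil_le.1 hav
      rw [div_le_iff₀ hq] at this; linarith
    have h2 : q * (v : ℕ) < 2 * w * k + w - Δ := by
      have := Nat.lt_ceil.1 hvb
      rw [lt_div_iff₀ hq] at this; linarith
    have hvU : (v : ℕ) ≤ U := by omega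
    have hl := abs_le.1 (h.left v hvU)
    have hr := abs_le.1 (h.right v hvU)
    obtain ⟨hk1, hk2⟩ := Finset.mem_inter.1 hv
    refine Finset.mem_inter.2 ⟨Finset.mem_filter.2 ⟨hk1, ?_, ?_⟩,
      Finset.mem_filter.2 ⟨hk2, ?_, ?_⟩⟩
    · have : (2 * w * k : ℝ) ≤ keptBelow κ v := by linarith
      exact_mod_cast this
    · have : (keptBelow κ v : ℝ) < 2 * w * k + w := by linarith
      exact_mod_cast this
    · have : (2 * w * k : ℝ) ≤ keptBelow κ' v := by linarith
      exact_mod_cast this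
    · have : (keptBelow κ' v : ℝ) < 2 * w * k + w := by linarith
      exact_mod_cast this
  have hcount : keptBoth κ κ' b ≤ keptBoth κ κ' a
      + ((kept κ ∩ kept κ').filter (fun v : Fin N => a ≤ (v : ℕ) ∧ (v : ℕ) < b)).card := by
    refine le_trans (Finset.card_le_card ?_) (Finset.card_union_le _ _)
    intro v hv
    simp only [Finset.mem_union, Finset.mem_filter] at hv ⊢
    by_cases hav : a ≤ (v : ℕ)
    · exact Or.inr ⟨hv.1, hav, hv.2⟩
    · exact Or.inl ⟨hv.1, by omega⟩
  have hcount' : (keptBoth κ κ' b : ℝ) ≤ keptBoth κ κ' a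
      + (originBlock κ w k ∩ originBlock κ' w k).card := by
    exact_mod_cast hcount.trans (Nat.add_le_add_left (Finset.card_le_card hsub) _)
  have hA := abs_le.1 (h.both a (hab.trans hbU))
  have hB := abs_le.1 (h.both b hbU)
  have hqb : 2 * w * k + w - Δ ≤ q * b := by rw [div_le_iff₀ hq] at hb'; linarith
  have hqa : q * a ≤ 2 * w * k + Δ + q := by
    have := mul_le_mul_of_nonneg_left ha'.le hq.le
    rw [mul_add, mul_div_cancel₀ _ hq.ne'] at this; linarith
  -- The overlap is at least `q (w - 2Δ - q) - 4Δ`. With `Δ = q w / 20` this is at least `0.7 q w -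
  -- q²`, and `5 ≤ q w` absorbs the `q²`.
  have : q * (w - 2 * Δ - q) ≤ q ^ 2 * b - q ^ 2 * a := by nlinarith
  nlinarith

end Blocks

/-! ### Concentration of the retention patterns -/

section Patterns

variable {N : ℕ} {p : unitInterval}

instance : IsProbabilityMeasure (patternLaw p N) := by unfold patternLaw; infer_instance

theorem integral_patternLaw_eval (v : Fin N) (f : Bool → ℝ) :
    ∫ κ, f (κ v) ∂(patternLaw p N) = p * f false + (1 - p) * f true := by
  have h := integral_comp_eval (μ := fun _ : Fin N => bernoulliMeasure false true p) (i := v)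
    (f := f) Measurable.of_discrete.aestronglyMeasurable
  rw [patternLaw, h, integral_bernoulliMeasure]
  simp

/-- Hoeffding's inequality for both tails. A common bound `U` on the sizes serves all the prefix
sets at once. -/
theorem patternLaw_deviation_le (S : Finset (Fin N)) {U : ℝ} (hS : (S.card : ℝ) ≤ U) {Δ : ℝ}
    (hΔ : 0 < Δ) :
    (patternLaw p N).real {κ | Δ < |((kept κ ∩ S).card : ℝ) - (1 - p) * S.card|}
      ≤ 2 * Real.exp (-(2 * Δ ^ 2 / U)) := by
  -- The empty set is separated because `U` may then be `0`, and the comparison of exponents needs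
  -- positive denominators.
  rcases S.eq_empty_or_nonempty with rfl | hS0
  · have : {κ : Pattern N | Δ < |((kept κ ∩ ∅).card : ℝ) - (1 - p) * (∅ : Finset (Fin N)).card|}
        = ∅ := by
      ext κ; simp [hΔ.le]
    rw [this, measureReal_empty]; positivity
  have hind : iIndepFun (fun (v : Fin N) (κ : Pattern N) => κ v) (patternLaw p N) :=
    iIndepFun_pi (X := fun _ b => b) fun _ => aemeasurable_id
  let X : Fin N → Bool → ℝ := fun _ b => (if b then 1 else 0) - (1 - p)
  have hX : ∀ v, HasSubgaussianMGF (fun κ : Pattern N => X v (κ v)) (1 / 4) (patternLaw p N) := by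
    intro v
    have := hasSubgaussianMGF_of_mem_Icc (μ := patternLaw p N)
      (X := fun κ : Pattern N => if κ v then (1 : ℝ) else 0) (a := 0) (b := 1)
      Measurable.of_discrete.aemeasurable (ae_of_all _ fun κ => by
        by_cases h : κ v <;> simp [h])
    rw [integral_patternLaw_eval v (fun b => if b then (1 : ℝ) else 0)] at this
    convert this using 1
    · ext κ; simp [X]
    · norm_num
  have e : ∀ κ : Pattern N, ∑ v ∈ S, X v (κ v) = ((kept κ ∩ S).card : ℝ) - (1 - p) * S.card := by
    intro κ
    simp only [X, Finset.sum_sub_distrib, Finset.sum_const, nsmul_eq_mul]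
    rw [← Finset.sum_filter, Finset.sum_const, nsmul_eq_mul, mul_one,
      show (S.filter fun v => κ v = true) = kept κ ∩ S by ext v; simp [kept, and_comm]]
    ring
  have hle : Real.exp (-Δ ^ 2 / (2 * ((∑ v ∈ S, (1 / 4 : NNReal) : NNReal) : ℝ)))
      ≤ Real.exp (-(2 * Δ ^ 2 / U)) := by
    have hc : (0 : ℝ) < S.card := by exact_mod_cast hS0.card_pos
    refine Real.exp_le_exp.2 ?_
    simp only [Finset.sum_const, nsmul_eq_mul]
    push_cast
    rw [neg_div, neg_le_neg_iff, div_le_div_iff₀ (hc.trans_le hS) (by positivity)]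
    nlinarith [sq_nonneg Δ]
  have h1 := HasSubgaussianMGF.measure_sum_ge_le_of_iIndepFun (s := S)
    (hind.comp X fun v => Measurable.of_discrete) (fun v _ => hX v) hΔ.le
  have h2 := HasSubgaussianMGF.measure_sum_ge_le_of_iIndepFun (s := S)
    (hind.comp (fun v b => -X v b) fun v => Measurable.of_discrete)
    (fun v _ => (hX v).neg) hΔ.le
  refine (measureReal_mono (s₂ := {κ | Δ ≤ ∑ v ∈ S, X v (κ v)} ∪
    {κ | Δ ≤ ∑ v ∈ S, -X v (κ v)}) ?_).trans ((measureReal_union_le _ _).trans ?_)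
  · intro κ hκ
    simp only [Set.mem_ofPred_eq, Set.mem_union, Finset.sum_neg_distrib, e] at hκ ⊢
    rcases lt_abs.1 hκ with h | h
    · exact Or.inl h.le
    · exact Or.inr h.le
  · rw [two_mul]
    exact add_le_add (h1.trans hle) (h2.trans hle)

end Patterns

/-! ### Products of measures on finite spaces -/

/-- Conditioning on the second coordinate: sections over `G` cost `ε`, and those outside are bounded
by `1`. -/
theorem measureReal_prod_le_of_sections {α β : Type*} [Finite α] [Finite β] [MeasurableSpace α]
    [MeasurableSpace β] [DiscreteMeasurableSpace α] [DiscreteMeasurableSpace β]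
    {μ : Measure α} {ν : Measure β} [IsProbabilityMeasure μ] [IsProbabilityMeasure ν]
    {S : Set (α × β)} {G : Set β} {ε : ℝ} (hε : 0 ≤ ε)
    (h : ∀ b ∈ G, μ.real {a | (a, b) ∈ S} ≤ ε) : (μ.prod ν).real S ≤ ε + ν.real Gᶜ := by
  have key : (μ.prod ν) S ≤ ENNReal.ofReal ε + ν Gᶜ := by
    rw [Measure.prod_apply_symm MeasurableSet.of_discrete]
    calc ∫⁻ b, μ ((fun a => (a, b)) ⁻¹' S) ∂ν
        ≤ ∫⁻ b, (ENNReal.ofReal ε + Gᶜ.indicator 1 b) ∂ν := by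
          refine lintegral_mono fun b => ?_
          by_cases hb : b ∈ G
          · refine le_add_right ?_
            rw [← ofReal_measureReal]
            exact ENNReal.ofReal_le_ofReal (h b hb)
          · refine le_add_left ?_
            rw [Set.indicator_of_mem (by exact hb)]
            exact prob_le_one
      _ = _ := by
          rw [lintegral_add_left measurable_const, lintegral_const, measure_univ, mul_one,
            lintegral_indicator_one MeasurableSet.of_discrete]
  have := ENNReal.toReal_mono (by simp) key
  rwa [ENNReal.toReal_add (by simp) (by simp), ENNReal.toReal_ofReal hε] at this

/-! ### Most pairs of patterns are regular -/

section RegularProb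

variable {N : ℕ} {p : unitInterval}

theorem keptBelow_eq (κ : Pattern N) (u : ℕ) :
    keptBelow κ u = (kept κ ∩ Finset.univ.filter fun v : Fin N => (v : ℕ) < u).card := by
  rw [keptBelow]; congr 1; ext v; simp

theorem keptBoth_eq (κ κ' : Pattern N) (u : ℕ) :
    keptBoth κ κ' u = (kept κ ∩ (kept κ').filter fun v : Fin N => (v : ℕ) < u).card := by
  rw [keptBoth]; congr 1; ext v; simp [and_assoc]

theorem card_filter_lt {u : ℕ} (hu : u ≤ N) :
    (Finset.univ.filter fun v : Fin N => (v : ℕ) < u).card = u := by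
  rw [Fin.card_filter_val_lt]; exact min_eq_right hu

/-- Union bound over `u ≤ U` of three Hoeffding events. For `keptBoth` the second pattern is fixed
first, so the centring is `(1 - p) * keptBelow κ' u`; replacing it by `(1 - p)² u` costs the second
`Δ` in `Regular`. -/
theorem not_regular_le {U : ℕ} (hU : U ≤ N) {Δ : ℝ} (hΔ : 0 < Δ) :
    ((patternLaw p N).prod (patternLaw p N)).real
      {κ | ¬ Regular (1 - p) Δ U κ.1 κ.2} ≤ 6 * (U + 1) * Real.exp (-(2 * Δ ^ 2 / U)) := by
  set μ := patternLaw p N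
  set e := Real.exp (-(2 * Δ ^ 2 / U))
  have he : 0 < e := Real.exp_pos _
  let E₁ : ℕ → Set (Pattern N × Pattern N) := fun u =>
    {κ | Δ < |(keptBelow κ.1 u : ℝ) - (1 - p) * u|}
  let E₂ : ℕ → Set (Pattern N × Pattern N) := fun u =>
    {κ | Δ < |(keptBelow κ.2 u : ℝ) - (1 - p) * u|}
  let E₃ : ℕ → Set (Pattern N × Pattern N) := fun u =>
    {κ | Δ < |(keptBoth κ.1 κ.2 u : ℝ) - (1 - p) * keptBelow κ.2 u|}
  have hp0 : 0 ≤ (1 : ℝ) - p := sub_nonneg.2 p.2.2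
  have hp1 : (1 : ℝ) - p ≤ 1 := sub_le_self _ p.2.1
  have hsub : {κ : Pattern N × Pattern N | ¬ Regular (1 - p) Δ U κ.1 κ.2}
      ⊆ ⋃ u ∈ Finset.range (U + 1), (E₁ u ∪ E₂ u ∪ E₃ u) := by
    intro κ hκ
    by_contra hcon
    simp only [Set.mem_iUnion, Finset.mem_range, Set.mem_union, Set.mem_ofPred_eq, not_exists,
      not_or, not_lt, E₁, E₂, E₃] at hcon
    refine hκ ⟨fun u hu => (hcon u (by omega)).1.1, fun u hu => (hcon u (by omega)).1.2,
      fun u hu => ?_⟩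
    obtain ⟨⟨-, h2⟩, h3⟩ := hcon u (by omega)
    have h4 : |(1 - (p : ℝ)) * (keptBelow κ.2 u - (1 - p) * u)| ≤ Δ := by
      rw [abs_mul, abs_of_nonneg hp0]
      nlinarith [abs_nonneg ((keptBelow κ.2 u : ℝ) - (1 - p) * u)]
    have e1 : (keptBoth κ.1 κ.2 u : ℝ) - (1 - p) ^ 2 * u
        = (keptBoth κ.1 κ.2 u - (1 - p) * keptBelow κ.2 u)
          + (1 - p) * (keptBelow κ.2 u - (1 - p) * u) := by ring
    rw [e1, two_mul]
    exact (abs_add_le _ _).trans (add_le_add h3 h4)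
  have hdev : ∀ u ≤ U, μ.real {κ | Δ < |(keptBelow κ u : ℝ) - (1 - p) * u|} ≤ 2 * e := by
    intro u hu
    have := patternLaw_deviation_le (p := p)
      (Finset.univ.filter fun v : Fin N => (v : ℕ) < u) (U := U)
      (by rw [card_filter_lt (hu.trans hU)]; exact_mod_cast hu) hΔ
    simpa only [← keptBelow_eq, card_filter_lt (hu.trans hU)] using this
  have h1 : ∀ u ≤ U, (μ.prod μ).real (E₁ u) ≤ 2 * e := by
    intro u hu
    have := measureReal_prod_le_of_sections (ν := μ) (μ := μ) (S := E₁ u) (G := Set.univ)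
      (ε := 2 * e) (by positivity) fun κ' _ => hdev u hu
    simpa using this
  have h2 : ∀ u ≤ U, (μ.prod μ).real (E₂ u) ≤ 2 * e := by
    intro u hu
    have := (measurePreserving_snd (μ := μ) (ν := μ)).measureReal_preimage
      (s := {κ | Δ < |(keptBelow κ u : ℝ) - (1 - p) * u|})
      MeasurableSet.of_discrete.nullMeasurableSet
    exact this.trans_le (hdev u hu)
  have h3 : ∀ u ≤ U, (μ.prod μ).real (E₃ u) ≤ 2 * e := by
    intro u hu
    have := measureReal_prod_le_of_sections (ν := μ) (μ := μ) (S := E₃ u) (G := Set.univ)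
      (ε := 2 * e) (by positivity) fun κ' _ => by
        have hcard : ((kept κ').filter fun v : Fin N => (v : ℕ) < u).card ≤ U := by
          refine le_trans (Finset.card_le_card (t := Finset.univ.filter fun v : Fin N =>
            (v : ℕ) < u) fun v hv => ?_) ((card_filter_lt (hu.trans hU)).trans_le hu)
          simpa using (Finset.mem_filter.1 hv).2
        have := patternLaw_deviation_le (p := p) (U := U)
          ((kept κ').filter fun v : Fin N => (v : ℕ) < u) (by exact_mod_cast hcard) hΔ
        simp only [← keptBoth_eq] at this
        exact this
    simpa using this
  calc _ ≤ (μ.prod μ).real (⋃ u ∈ Finset.range (U + 1), (E₁ u ∪ E₂ u ∪ E₃ u)) :=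
        measureReal_mono hsub (measure_ne_top _ _)
    _ ≤ ∑ u ∈ Finset.range (U + 1), (μ.prod μ).real (E₁ u ∪ E₂ u ∪ E₃ u) :=
        measureReal_biUnion_finset_le _ _
    _ ≤ ∑ _u ∈ Finset.range (U + 1), 6 * e := by
        refine Finset.sum_le_sum fun u hu => ?_
        have hu : u ≤ U := by have := Finset.mem_range.1 hu; omega
        have a := measureReal_union_le (μ := μ.prod μ) (E₁ u ∪ E₂ u) (E₃ u)
        have b := measureReal_union_le (μ := μ.prod μ) (E₁ u) (E₂ u)
        linarith [h1 u hu, h2 u hu, h3 u hu]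
    _ = _ := by
        rw [Finset.sum_const, Finset.card_range, nsmul_eq_mul]; push_cast; ring

end RegularProb

/-! ### The median test -/

section Test

variable {N : ℕ} {q c Δ : ℝ} {U : ℕ} {κ κ' : Pattern N}

instance : IsProbabilityMeasure (stringLaw N) := by unfold stringLaw; infer_instance

theorem le_groupSize_mul (hq : 0 < q) : 96 ≤ groupSize q * q ^ 2 := by
  have := Nat.le_ceil (96 / q ^ 2)
  rwa [div_le_iff₀ (by positivity)] at this

theorem groupSum_cast (t t' : List Bool) (j : ℕ) :
    (groupSum q N t t' j : ℝ)
      = ∑ i : Fin (groupSize q), (blockSq (blockLen q N) t t' (j * groupSize q + i) : ℝ) := by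
  rw [groupSum, Int.cast_sum, Finset.sum_range]

theorem block_index_lt {L g : ℕ} (j : Fin (2 * L + 1)) (i : Fin g) :
    (j : ℕ) * g + i < (2 * L + 1) * g := by
  have := (finProdFinEquiv (j, i)).2
  rw [finProdFinEquiv_apply_val] at this
  simp only at this
  rw [mul_comm (j : ℕ)]; omega

theorem block_index_ne {L g : ℕ} {k l : Fin (2 * L + 1) × Fin g} (h : k ≠ l) :
    (k.1 : ℕ) * g + k.2 ≠ l.1 * g + l.2 := by
  intro e
  refine h (finProdFinEquiv.injective (Fin.ext ?_))
  rw [finProdFinEquiv_apply_val, finProdFinEquiv_apply_val]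
  rw [mul_comm g, mul_comm g]; omega

/-- The overlap of at least `q w / 2` puts each group mean at most at `(1 - q/2) g w / 2`, which is
`g q w / 8` below the threshold. An error of the median therefore makes a majority of groups deviate
by that much. -/
theorem measureReal_not_testSame_le_of_regular (h : Regular q Δ U κ κ') (hq : 0 < q)
    (hq1 : q ≤ 1) (hΔ : Δ = q * blockLen q N / 20) (hw : 5 ≤ q * blockLen q N)
    (hK : (2 * blockLen q N * ((2 * ⌈c * logSize N⌉₊ + 1) * groupSize q : ℕ) : ℝ)
      ≤ q * U - Δ) :
    (stringLaw N).real {x | ¬ TestSame c q N (stringTrace x κ) (stringTrace x κ')}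
      ≤ (8 / 9) ^ ⌈c * logSize N⌉₊ := by
  set L := ⌈c * logSize N⌉₊
  set g := groupSize q
  set w := blockLen q N
  have hw0 : (0 : ℝ) < w := by
    by_contra hcon
    have : q * w ≤ 0 := mul_nonpos_of_nonneg_of_nonpos hq.le (not_lt.1 hcon)
    linarith
  have hA : ∀ (j : Fin (2 * L + 1)) (i : Fin g), (originBlock κ w (j * g + i)).card = w :=
    fun j i => card_originBlock (h.block_le_card hK (block_index_lt j i))
  have hB : ∀ (j : Fin (2 * L + 1)) (i : Fin g), (originBlock κ' w (j * g + i)).card = w :=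
    fun j i => card_originBlock (h.symm.block_le_card hK (block_index_lt j i))
  refine le_trans (measureReal_mono ?_) (measureReal_groups_deviate_le
    (le_groupSize_mul hq) hq hw0 (fun (j : Fin (2 * L + 1)) (i : Fin g) =>
      originBlock κ w (j * g + i))
    (fun j i => originBlock κ' w (j * g + i)) (fun j i => by rw [hA])
    (fun j i => by rw [hA, hB]) fun k l hkl =>
      h.disjoint_blocks hK (by rw [hΔ]; nlinarith) (block_index_lt _ _) (block_index_lt _ _)
        (block_index_ne hkl))
  intro x hx
  have hmed := card_of_le_median (not_lt.1 hx)
  refine hmed.trans (Nat.card_mono (Set.toFinite _) fun j hj => ?_)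
  have hj : threshold q N ≤ groupSum q N (stringTrace x κ) (stringTrace x κ') j := hj
  rw [groupSum_cast] at hj
  have hz : ∀ i : Fin g, (blockSq w (stringTrace x κ) (stringTrace x κ') (j * g + i) : ℝ)
      = (signedSum (originBlock κ w (j * g + i)) (originBlock κ' w (j * g + i)) x : ℝ) ^ 2 := by
    intro i
    rw [blockSq_same x (h.block_le_card hK (block_index_lt j i))
      (h.symm.block_le_card hK (block_index_lt j i))]
    push_cast; rfl
  simp only [w, g] at hz
  simp only [hz] at hj
  rw [Set.mem_ofPred_eq]
  refine le_trans ?_ (le_abs_self _)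
  have hmean : ∑ i : Fin g, ((w : ℝ)
      - (originBlock κ w (j * g + i) ∩ originBlock κ' w (j * g + i)).card) / 2
      ≤ g * ((w - q * w / 2) / 2) := by
    calc _ ≤ ∑ _i : Fin g, ((w - q * w / 2) / 2 : ℝ) := by
          refine Finset.sum_le_sum fun i _ => ?_
          have := h.card_inter_ge hK hq hq1 hΔ hw (block_index_lt j i)
          linarith
      _ = _ := by simp
  have ht : threshold q N = (1 - q / 4) * g * w / 2 := rfl
  rw [ht] at hj
  have hj' := sub_le_sub hj hmean
  refine le_trans ?_ hj'
  linarith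

/-- Here the overlaps are empty and each group mean is exactly `g w / 2`, which is `g q w / 8` above
the threshold. -/
theorem measureReal_testSame_le_of_regular (h : Regular q Δ U κ κ') (hq : 0 < q)
    (hq1 : q ≤ 1) (hΔ : Δ = q * blockLen q N / 20) (hw : 5 ≤ q * blockLen q N)
    (hK : (2 * blockLen q N * ((2 * ⌈c * logSize N⌉₊ + 1) * groupSize q : ℕ) : ℝ)
      ≤ q * U - Δ) :
    ((stringLaw N).prod (stringLaw N)).real
      {x | TestSame c q N (stringTrace x.1 κ) (stringTrace x.2 κ')}
      ≤ (8 / 9) ^ ⌈c * logSize N⌉₊ := by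
  set L := ⌈c * logSize N⌉₊
  set g := groupSize q
  set w := blockLen q N
  have hw0 : (0 : ℝ) < w := by
    by_contra hcon
    have : q * w ≤ 0 := mul_nonpos_of_nonneg_of_nonpos hq.le (not_lt.1 hcon)
    linarith
  have hA : ∀ (j : Fin (2 * L + 1)) (i : Fin g), (originBlock κ w (j * g + i)).card = w :=
    fun j i => card_originBlock (h.block_le_card hK (block_index_lt j i))
  have hB : ∀ (j : Fin (2 * L + 1)) (i : Fin g), (originBlock κ' w (j * g + i)).card = w :=
    fun j i => card_originBlock (h.symm.block_le_card hK (block_index_lt j i))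
  have hmp := measurePreserving_sumPiEquivProdPi (X := fun _ : Fin N ⊕ Fin N => Bool)
    (fun _ => fairBit)
  have hpre := hmp.measureReal_preimage
    (s := {x : (Fin N → Bool) × (Fin N → Bool) |
      TestSame c q N (stringTrace x.1 κ) (stringTrace x.2 κ')})
    MeasurableSet.of_discrete.nullMeasurableSet
  refine hpre.symm.trans_le ?_
  refine le_trans (measureReal_mono ?_) (measureReal_groups_deviate_le
    (le_groupSize_mul hq) hq hw0 (fun (j : Fin (2 * L + 1)) (i : Fin g) =>
      (originBlock κ w (j * g + i)).map ⟨Sum.inl, Sum.inl_injective⟩)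
    (fun j i => (originBlock κ' w (j * g + i)).map ⟨Sum.inr, Sum.inr_injective⟩)
    (fun j i => by rw [Finset.card_map, hA])
    (fun j i => by rw [Finset.card_map, Finset.card_map, hA, hB]) fun k l hkl => ?_)
  · intro x hx
    have hmed := card_of_median_lt (show (median _ : ℝ) < _ from hx)
    refine hmed.trans (Nat.card_mono (Set.toFinite _) fun j hj => ?_)
    have hj : (groupSum q N (stringTrace (fun i => x (Sum.inl i)) κ)
      (stringTrace (fun i => x (Sum.inr i)) κ') j : ℝ) < threshold q N := hj
    rw [groupSum_cast] at hj
    have hz : ∀ i : Fin g, (blockSq w (stringTrace (fun i => x (Sum.inl i)) κ)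
        (stringTrace (fun i => x (Sum.inr i)) κ') (j * g + i) : ℝ)
        = (signedSum ((originBlock κ w (j * g + i)).map ⟨Sum.inl, Sum.inl_injective⟩)
          ((originBlock κ' w (j * g + i)).map ⟨Sum.inr, Sum.inr_injective⟩) x : ℝ) ^ 2 := by
      intro i
      rw [blockSq_indep _ _ (h.block_le_card hK (block_index_lt j i))
        (h.symm.block_le_card hK (block_index_lt j i))]
      push_cast
      congr 3
      exact Sum.elim_comp_inl_inr x
    simp only [w, g] at hz
    simp only [hz] at hj
    have hempty : ∀ i : Fin g,
        ((originBlock κ w (j * g + i)).map ⟨Sum.inl, Sum.inl_injective⟩ ∩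
          (originBlock κ' w (j * g + i)).map
            (⟨Sum.inr, Sum.inr_injective⟩ : Fin N ↪ Fin N ⊕ Fin N)) = ∅ := by
      intro i; ext v; cases v <;> simp
    have hmean : ∑ i : Fin g, ((w : ℝ)
        - ((originBlock κ w (j * g + i)).map ⟨Sum.inl, Sum.inl_injective⟩ ∩
          (originBlock κ' w (j * g + i)).map
            (⟨Sum.inr, Sum.inr_injective⟩ : Fin N ↪ Fin N ⊕ Fin N)).card) / 2
        = g * (w / 2) := by
      simp [hempty]
    have ht : threshold q N = (1 - q / 4) * g * w / 2 := rfl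
    rw [ht] at hj
    rw [Set.mem_ofPred_eq]
    refine le_trans ?_ (neg_le_abs _)
    rw [neg_sub]
    have hj' := sub_le_sub hmean.ge hj.le
    refine le_trans ?_ hj'
    linarith
  · have hd := h.disjoint_blocks hK (by rw [hΔ]; nlinarith) (block_index_lt k.1 k.2)
      (block_index_lt l.1 l.2) (block_index_ne hkl)
    rw [Finset.disjoint_left] at hd ⊢
    rintro (v | v) hv hv'
    · simp only [Finset.mem_union, Finset.mem_map, Function.Embedding.coeFn_mk, Sum.inl.injEq,
        exists_eq_right, reduceCtorEq, and_false, exists_false, or_false] at hv hv'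
      exact hd (Finset.mem_union_left _ hv) (Finset.mem_union_left _ hv')
    · simp only [Finset.mem_union, Finset.mem_map, Function.Embedding.coeFn_mk, Sum.inr.injEq,
        exists_eq_right, reduceCtorEq, and_false, exists_false, false_or] at hv hv'
      exact hd (Finset.mem_union_right _ hv) (Finset.mem_union_right _ hv')

end Test

/-! ### Asymptotics of the parameters -/

theorem tendsto_natCast_rpow {r : ℝ} (hr : 0 < r) :
    Tendsto (fun N : ℕ => (N : ℝ) ^ r) atTop atTop :=
  (tendsto_rpow_atTop hr).comp tendsto_natCast_atTop_atTop

theorem logSize_eq (N : ℕ) : logSize N = 2 * Real.log N := by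
  rw [logSize, Real.log_pow]; norm_num

theorem eventually_logSize_le {r : ℝ} (hr : 0 < r) :
    ∀ᶠ N : ℕ in atTop, logSize N ≤ (N : ℝ) ^ r := by
  have h := ((isLittleO_log_rpow_atTop hr).def (c := 1 / 2) (by norm_num))
  filter_upwards [tendsto_natCast_atTop_atTop.eventually h, eventually_ge_atTop 1] with N hN h1
  have h1' : (1 : ℝ) ≤ N := by exact_mod_cast h1
  rw [Real.norm_of_nonneg (Real.log_nonneg h1'), Real.norm_of_nonneg (by positivity)] at hN
  rw [logSize_eq]; linarith

theorem eventually_one_le_logSize : ∀ᶠ N : ℕ in atTop, 1 ≤ logSize N := by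
  filter_upwards [eventually_ge_atTop 3] with N hN
  have h : Real.exp 1 ≤ N := by
    have : (3 : ℝ) ≤ N := by exact_mod_cast hN
    linarith [Real.exp_one_lt_d9]
  have : 1 ≤ Real.log N := (Real.le_log_iff_exp_le (by linarith [Real.exp_pos 1])).2 h
  rw [logSize_eq]; linarith

variable {q : ℝ}

theorem le_blockLen (q : ℝ) (N : ℕ) : 100 * √(N : ℝ) * √(logSize N / q) ≤ blockLen q N :=
  Nat.le_ceil _

theorem eventually_le_mul_blockLen (hq : 0 < q) (hq1 : q ≤ 1) :
    ∀ᶠ N : ℕ in atTop, 5 ≤ q * blockLen q N := by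
  have h := (tendsto_natCast_rpow (r := 1 / 2) (by norm_num)).eventually_ge_atTop (1 / q)
  filter_upwards [h, eventually_one_le_logSize] with N hN hl
  rw [← Real.sqrt_eq_rpow] at hN
  have h1 : 1 ≤ √(logSize N / q) := by
    rw [Real.one_le_sqrt, le_div_iff₀ hq]; linarith
  have h2 := le_blockLen q N
  have h3 : 1 ≤ q * √(N : ℝ) := by
    rw [div_le_iff₀ hq] at hN; linarith
  have h4 : √(N : ℝ) ≤ √(N : ℝ) * √(logSize N / q) :=
    le_mul_of_one_le_right (Real.sqrt_nonneg _) h1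
  nlinarith

/-- In terms of `y = N ^ (1/8)`, with `logSize N ≤ y`, the block length is `O(y⁵)` and the number of
blocks `O(y)`. All blocks thus need `O(y⁶)` positions, against `q² N = q² y⁸` available. -/
theorem eventually_blocks_fit (hq : 0 < q) (hq1 : q ≤ 1) {c : ℝ} (hc : 0 ≤ c) :
    ∀ᶠ N : ℕ in atTop,
      (2 * blockLen q N * ((2 * ⌈c * logSize N⌉₊ + 1) * groupSize q : ℕ) : ℝ)
        ≤ q * ⌊q * N⌋₊ - q * blockLen q N / 20 := by
  set a : ℝ := 100 / q + 101
  set b : ℝ := (2 * (2 * c + 3) * groupSize q + 1)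
  have h := (tendsto_natCast_rpow (r := 1 / 8) (by norm_num)).eventually_ge_atTop
    (1 + (a * b + 1) / q ^ 2)
  filter_upwards [h, eventually_one_le_logSize,
    eventually_logSize_le (r := 1 / 8) (by norm_num)] with N hN hl hly
  set y : ℝ := (N : ℝ) ^ (1 / 8 : ℝ)
  have ha : 0 < a := by positivity
  have hb : 0 < b := by positivity
  have hy1 : 1 ≤ y := le_trans (le_add_of_nonneg_right (by positivity)) hN
  have hy8 : y ^ 8 = N := by
    rw [← Real.rpow_natCast, ← Real.rpow_mul (Nat.cast_nonneg _)]; norm_num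
  have hy4 : √(N : ℝ) = y ^ 4 := by
    rw [← hy8, show y ^ 8 = (y ^ 4) ^ 2 by ring, Real.sqrt_sq (by positivity)]
  have hlq : √(logSize N / q) ≤ y / q + 1 := by
    have h1 : logSize N / q ≤ y / q := by gcongr
    have h0 : 0 ≤ y / q := by positivity
    refine (Real.sqrt_le_left (by positivity)).2 ?_
    nlinarith
  have hw : (blockLen q N : ℝ) ≤ a * y ^ 5 := by
    have h1 : (blockLen q N : ℝ) < 100 * √(N : ℝ) * √(logSize N / q) + 1 :=
      Nat.ceil_lt_add_one (by positivity)
    have h2 : 100 * √(N : ℝ) * √(logSize N / q) ≤ 100 * y ^ 4 * (y / q + 1) := by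
      rw [hy4]; gcongr
    have h3 : y ^ 4 ≤ y ^ 5 := pow_le_pow_right₀ hy1 (by norm_num)
    have h4 : 1 ≤ y ^ 5 := one_le_pow₀ hy1
    have h5 : 100 * y ^ 4 * (y / q + 1) = 100 / q * y ^ 5 + 100 * y ^ 4 := by ring
    have h6 : a * y ^ 5 = 100 / q * y ^ 5 + 101 * y ^ 5 := by simp only [a]; ring
    linarith
  have hL : (⌈c * logSize N⌉₊ : ℝ) ≤ c * y + 1 := by
    have h1 : (⌈c * logSize N⌉₊ : ℝ) < c * logSize N + 1 :=
      Nat.ceil_lt_add_one (mul_nonneg hc (by linarith))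
    nlinarith
  have hU : q * N - 1 ≤ ⌊q * N⌋₊ := (Nat.sub_one_lt_floor _).le
  have hK : (2 * ((2 * ⌈c * logSize N⌉₊ + 1) * groupSize q : ℕ) + 1 : ℝ) ≤ b * y := by
    push_cast
    have hg : (0 : ℝ) ≤ groupSize q := Nat.cast_nonneg _
    have h1 : (2 * (⌈c * logSize N⌉₊ : ℝ) + 1) ≤ (2 * c + 3) * y := by nlinarith
    have h2 := mul_le_mul_of_nonneg_right h1 hg
    simp only [b]; nlinarith
  have hprod : (blockLen q N : ℝ)
      * (2 * ((2 * ⌈c * logSize N⌉₊ + 1) * groupSize q : ℕ) + 1) ≤ (a * y ^ 5) * (b * y) := by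
    gcongr
  have hfin : (a * y ^ 5) * (b * y) + 1 ≤ q ^ 2 * N := by
    have h1 : (a * b + 1) / q ^ 2 ≤ y := by linarith
    rw [div_le_iff₀ (by positivity)] at h1
    have h2 : a * b + 1 ≤ q ^ 2 * y ^ 2 := by
      have : y ≤ y ^ 2 := by nlinarith
      have := mul_le_mul_of_nonneg_left this (sq_nonneg q)
      linarith
    have h3 : 1 ≤ y ^ 6 := one_le_pow₀ hy1
    have h4 := mul_le_mul_of_nonneg_right h2 (zero_le_one.trans h3)
    rw [← hy8]; nlinarith
  have hw0 : (0 : ℝ) ≤ blockLen q N := Nat.cast_nonneg _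
  have hqw : q * blockLen q N ≤ blockLen q N := mul_le_of_le_one_left hw0 hq1
  have hqU := mul_le_mul_of_nonneg_left hU hq.le
  nlinarith

/-- Only the first `U = ⌊q N⌋` positions are controlled: from `w² ≥ 10⁴ N log n / q` and `U ≤ q N`
all powers of `q` cancel, leaving the exponent `50 log n`. -/
theorem exp_deviation_le (hq : 0 < q) {N : ℕ} (hl : 0 ≤ logSize N) (hU : 0 < ⌊q * N⌋₊) :
    Real.exp (-(2 * (q * blockLen q N / 20) ^ 2 / ⌊q * N⌋₊)) ≤ Real.exp (-(50 * logSize N)) := by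
  have hU' : (0 : ℝ) < ⌊q * N⌋₊ := by exact_mod_cast hU
  have hUN : (⌊q * N⌋₊ : ℝ) ≤ q * N := Nat.floor_le (by positivity)
  refine Real.exp_le_exp.2 (neg_le_neg ?_)
  rw [le_div_iff₀ hU']
  have h1 := pow_le_pow_left₀ (by positivity) (le_blockLen q N) 2
  rw [mul_pow, mul_pow, Real.sq_sqrt (Nat.cast_nonneg _), Real.sq_sqrt (by positivity)] at h1
  have h2 : 50 * logSize N * (q * N) ≤ 2 * (q * blockLen q N / 20) ^ 2 := by
    have h3 := mul_le_mul_of_nonneg_left h1 (sq_nonneg q)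
    have h4 : q ^ 2 * (100 ^ 2 * (N : ℝ) * (logSize N / q)) = 10000 * (q * N * logSize N) := by
      field_simp; ring
    rw [h4] at h3
    nlinarith
  exact le_trans (by gcongr) h2

theorem exp_neg_logSize {N : ℕ} (hN : 0 < N) (k : ℕ) :
    Real.exp (-(k * logSize N)) = (1 / (N : ℝ) ^ 2) ^ k := by
  have h : (0 : ℝ) < (N : ℝ) ^ 2 := by positivity
  rw [← mul_neg, Real.exp_nat_mul, Real.exp_neg, logSize, Real.exp_log h, one_div]

/-- Since `8/9 ≤ exp (-1/9)` and `100/9 ≥ 11`, the choice `c ≥ 100` gives `n ^ (-11)`, one power of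
`n` to spare. -/
theorem majority_bound_le {N : ℕ} {c : ℝ} (hc : 100 ≤ c) (hl : 0 ≤ logSize N) :
    (8 / 9 : ℝ) ^ ⌈c * logSize N⌉₊ ≤ Real.exp (-(11 * logSize N)) := by
  have h1 : (8 / 9 : ℝ) ≤ Real.exp (-(1 / 9)) := by
    have := Real.add_one_le_exp (-(1 / 9 : ℝ)); linarith
  calc (8 / 9 : ℝ) ^ ⌈c * logSize N⌉₊ ≤ Real.exp (-(1 / 9)) ^ ⌈c * logSize N⌉₊ := by gcongr
    _ = Real.exp (⌈c * logSize N⌉₊ * -(1 / 9)) := by rw [Real.exp_nat_mul]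
    _ ≤ _ := by
      refine Real.exp_le_exp.2 ?_
      have := Nat.le_ceil (c * logSize N)
      nlinarith

/-! ### The error probabilities of the median test -/

section ErrorProb

variable {p : unitInterval}

theorem eventually_error_bound (hp : p < 1) {c : ℝ} (hc : 100 ≤ c) :
    ∀ᶠ N : ℕ in atTop, ∃ G : Set (Pattern N × Pattern N),
      (8 / 9 : ℝ) ^ ⌈c * logSize N⌉₊ + ((patternLaw p N).prod (patternLaw p N)).real Gᶜ
        ≤ 1 / ((N : ℝ) ^ 2) ^ 10 ∧
      ∀ κ ∈ G,
        (stringLaw N).real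
          {x | ¬ TestSame c (1 - p) N (stringTrace x κ.1) (stringTrace x κ.2)}
          ≤ (8 / 9) ^ ⌈c * logSize N⌉₊ ∧
        ((stringLaw N).prod (stringLaw N)).real
          {x | TestSame c (1 - p) N (stringTrace x.1 κ.1) (stringTrace x.2 κ.2)}
          ≤ (8 / 9) ^ ⌈c * logSize N⌉₊ := by
  have hp' : (p : ℝ) < 1 := hp
  have hq : 0 < 1 - (p : ℝ) := sub_pos.2 hp'
  have hq1 : 1 - (p : ℝ) ≤ 1 := sub_le_self _ p.2.1
  filter_upwards [eventually_le_mul_blockLen hq hq1,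
    eventually_blocks_fit hq hq1 (by linarith : (0 : ℝ) ≤ c), eventually_one_le_logSize,
    eventually_ge_atTop 4] with N hw hK hl hN
  set q : ℝ := 1 - p
  have hw0 : (0 : ℝ) < blockLen q N := by
    by_contra hcon
    have : q * blockLen q N ≤ 0 := mul_nonpos_of_nonneg_of_nonpos hq.le (not_lt.1 hcon)
    linarith
  have hUN : ⌊q * N⌋₊ ≤ N := Nat.floor_le_of_le (mul_le_of_le_one_left (Nat.cast_nonneg _) hq1)
  have hU0 : 0 < ⌊q * N⌋₊ := by
    by_contra hcon
    have h0 : ⌊q * N⌋₊ = 0 := by omega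
    rw [h0] at hK
    have : (0 : ℝ) ≤ 2 * blockLen q N * ((2 * ⌈c * logSize N⌉₊ + 1) * groupSize q : ℕ) := by
      positivity
    have : 0 < q * blockLen q N / 20 := by positivity
    simp only [Nat.cast_zero, mul_zero] at hK
    linarith
  refine ⟨{κ | Regular q (q * blockLen q N / 20) ⌊q * N⌋₊ κ.1 κ.2}, ?_, fun κ hκ =>
    ⟨measureReal_not_testSame_le_of_regular hκ hq hq1 rfl hw hK,
      measureReal_testSame_le_of_regular hκ hq hq1 rfl hw hK⟩⟩
  have hreg := not_regular_le (p := p) hUN (Δ := q * blockLen q N / 20) (by positivity)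
  have hexp := exp_deviation_le hq (zero_le_one.trans hl) hU0
  have hmaj := majority_bound_le hc (zero_le_one.trans hl)
  have e1 := exp_neg_logSize (N := N) (by omega) 11
  have e2 := exp_neg_logSize (N := N) (by omega) 50
  push_cast at e1 e2
  rw [e1] at hmaj
  rw [e2] at hexp
  -- With `t = 1/n` the total error is at most `t ^ 11 + 12 N t ^ 50`. As `N t ≤ 1` and `t ≤ 1/16`,
  -- this is at most `(13/16) t ^ 10`.
  set t : ℝ := 1 / (N : ℝ) ^ 2 with ht
  have hN' : (4 : ℝ) ≤ N := by exact_mod_cast hN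
  have ht0 : 0 < t := by positivity
  have ht1 : t ≤ 1 / 16 := by
    rw [ht]; gcongr; nlinarith
  have hNt : N * t ≤ 1 := by
    rw [ht, mul_one_div, div_le_one (by positivity)]; nlinarith
  have hUN' : (⌊q * N⌋₊ : ℝ) ≤ N := by exact_mod_cast hUN
  have hgoal : 1 / ((N : ℝ) ^ 2) ^ 10 = t ^ 10 := by rw [ht, one_div_pow]
  have hbad : ((patternLaw p N).prod (patternLaw p N)).real
      {κ | Regular q (q * blockLen q N / 20) ⌊q * N⌋₊ κ.1 κ.2}ᶜ ≤ 12 * (N * t) * t ^ 49 := by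
    refine hreg.trans ?_
    calc _ ≤ 6 * ((⌊q * N⌋₊ : ℝ) + 1) * t ^ 50 := by gcongr
      _ ≤ 6 * (2 * N) * t ^ 50 := by gcongr; linarith
      _ = _ := by ring
  have h49 : t ^ 49 ≤ t ^ 10 * (1 / 16) := by
    calc t ^ 49 ≤ t ^ 11 := pow_le_pow_of_le_one ht0.le (by linarith) (by norm_num)
      _ = t ^ 10 * t := by ring
      _ ≤ _ := by gcongr
  have h11 : t ^ 11 ≤ t ^ 10 * (1 / 16) := by
    calc t ^ 11 = t ^ 10 * t := by ring
      _ ≤ _ := by gcongr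
  have h12 : 12 * (N * t) * t ^ 49 ≤ 12 * 1 * t ^ 49 := by gcongr
  have : 0 < t ^ 10 := by positivity
  rw [hgoal]
  linarith

theorem eventually_not_testSame_le (hp : p < 1) {c : ℝ} (hc : 100 ≤ c) :
    ∀ᶠ N : ℕ in atTop, ((stringLaw N).prod ((patternLaw p N).prod (patternLaw p N))).real
      {ω | ¬ TestSame c (1 - p) N (stringTrace ω.1 ω.2.1) (stringTrace ω.1 ω.2.2)}
        ≤ 1 / ((N : ℝ) ^ 2) ^ 10 := by
  filter_upwards [eventually_error_bound hp hc] with N ⟨G, hG, h⟩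
  exact (measureReal_prod_le_of_sections (by positivity) fun κ hκ => (h κ hκ).1).trans hG

theorem eventually_testSame_le (hp : p < 1) {c : ℝ} (hc : 100 ≤ c) :
    ∀ᶠ N : ℕ in atTop,
      (((stringLaw N).prod (stringLaw N)).prod ((patternLaw p N).prod (patternLaw p N))).real
      {ω | TestSame c (1 - p) N (stringTrace ω.1.1 ω.2.1) (stringTrace ω.1.2 ω.2.2)}
        ≤ 1 / ((N : ℝ) ^ 2) ^ 10 := by
  filter_upwards [eventually_error_bound hp hc] with N ⟨G, hG, h⟩
  exact (measureReal_prod_le_of_sections (by positivity) fun κ hκ => (h κ hκ).2).trans hG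

theorem one_sub_le_of_compl_le {Ω : Type*} [MeasurableSpace Ω] [DiscreteMeasurableSpace Ω]
    {μ : Measure Ω} [IsProbabilityMeasure μ] {S : Set Ω} {ε : ℝ} (h : μ.real Sᶜ ≤ ε) :
    1 - ε ≤ μ.real S := by
  rw [probReal_compl_eq_one_sub MeasurableSet.of_discrete] at h; linarith

end ErrorProb

/-! ### Alignment is determined by the test -/

section Alignment

variable {N m : ℕ}

/-- Agreement across traces makes the label a function `f` of the true index. Two indices retained
by a common trace are labelled in order, so `f` is strictly increasing on `Fin N`, hence the
identity. -/
theorem orderEmbedding_eq_origin {κ : Fin m → Pattern N}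
    {lab : (a : Fin m) → Fin (kept (κ a)).card ↪o Fin N}
    (hlab : ∀ a b, a ≠ b → ∀ k l, origin (κ a) k = origin (κ b) l ↔ lab a k = lab b l)
    (hcov : ∀ i j, ∃ a, κ a i = true ∧ κ a j = true) : lab = fun a => origin (κ a) := by
  have hex : ∀ i, ∃ (a : Fin m) (k : Fin (kept (κ a)).card), origin (κ a) k = i := fun i =>
    let ⟨a, h, _⟩ := hcov i i
    ⟨a, exists_origin_eq h⟩
  choose A K hAK using hex
  set f : Fin N → Fin N := fun i => lab (A i) (K i) with hf
  have hcons : ∀ a k, lab a k = f (origin (κ a) k) := by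
    intro a k
    rw [hf]
    -- The hypothesis compares different traces only; within one trace, injectivity of `origin` is
    -- used instead.
    by_cases h : a = A (origin (κ a) k)
    · have key : ∀ b (l : Fin (kept (κ b)).card), a = b → origin (κ b) l = origin (κ a) k →
          lab a k = lab b l := by
        rintro b l rfl hl
        rw [(origin (κ a)).injective hl]
      exact key _ _ h (hAK _)
    · exact (hlab _ _ h _ _).1 (hAK _).symm
  have hmono : StrictMono f := by
    intro i j hij
    obtain ⟨a, hi, hj⟩ := hcov i j
    obtain ⟨k, rfl⟩ := exists_origin_eq hi
    obtain ⟨l, rfl⟩ := exists_origin_eq hj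
    rw [← hcons, ← hcons]
    exact (lab a).lt_iff_lt.2 ((origin (κ a)).lt_iff_lt.1 hij)
  have hid : f = id := hmono.eq_id
  funext a
  ext k
  rw [hcons, hid, id]

/-- The tests between all rows of different traces give the right answer. -/
def RowsSeparated (c q : ℝ) (ω : Sample N m) : Prop :=
  ∀ a b, a ≠ b → ∀ i j, TestSame c q N (stringTrace (ω.1 i) (ω.2 a).2)
    (stringTrace (ω.1 j) (ω.2 b).2) ↔ i = j

/-- The matrix and the patterns with rows and columns exchanged. -/
def transposeSample (ω : Sample N m) : Sample N m :=
  (fun i j => ω.1 j i, fun a => (ω.2 a).swap)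

/-- Any two rows, any two columns, and every entry are retained by some trace. -/
def Covered (κ : Fin m → Pattern N × Pattern N) : Prop :=
  ∀ i j, (∃ a, (κ a).1 i = true ∧ (κ a).1 j = true) ∧
    (∃ a, (κ a).2 i = true ∧ (κ a).2 j = true) ∧ ∃ a, (κ a).1 i = true ∧ (κ a).2 j = true

theorem aligned_iff_and_fits_iff {c q : ℝ} {ω : Sample N m} (hr : RowsSeparated c q ω)
    (hc : RowsSeparated c q (transposeSample ω)) (hcov : Covered ω.2) :
    (∀ lab : Labelling N (traces ω), lab.IsAligned c q ↔ lab = trueLabelling ω) ∧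
      ∀ Y : Fin N → Fin N → Bool, (trueLabelling ω).Fits Y ↔ Y = ω.1 := by
  refine ⟨fun lab => ⟨fun h => ?_, ?_⟩, fun Y => ⟨fun h => ?_, ?_⟩⟩
  · refine Labelling.ext ?_ ?_
    · exact orderEmbedding_eq_origin (κ := fun a => (ω.2 a).1) (lab := lab.row)
        -- A row of a matrix trace is, by definition, the string trace of the original row under the
        -- column pattern.
        (fun a b hab k l => (hr a b hab _ _).symm.trans ((h a b hab).1 k l))
        fun i j => (hcov i j).1
    · exact orderEmbedding_eq_origin (κ := fun a => (ω.2 a).2) (lab := lab.col)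
        (fun a b hab k l => (hc a b hab _ _).symm.trans ((h a b hab).2 k l))
        fun i j => (hcov i j).2.1
  · rintro rfl a b hab
    exact ⟨fun k l => hr a b hab _ _, fun k l => hc a b hab _ _⟩
  · funext i j
    obtain ⟨a, hi, hj⟩ := (hcov i j).2.2
    obtain ⟨k, rfl⟩ := exists_origin_eq hi
    obtain ⟨l, rfl⟩ := exists_origin_eq hj
    exact h a k l
  · rintro rfl a k l
    rfl

end Alignment

/-! ### Marginals of the sample law -/

section Marginals

theorem measurePreserving_pair {ι β : Type*} [Fintype ι] [MeasurableSpace β]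
    (μ : Measure β) [IsProbabilityMeasure μ] {i j : ι} (hij : i ≠ j) :
    MeasurePreserving (fun x : ι → β => (x i, x j)) (Measure.pi fun _ => μ) (μ.prod μ) := by
  refine ⟨by fun_prop, ?_⟩
  have h : iIndepFun (fun (v : ι) (x : ι → β) => x v) (Measure.pi fun _ : ι => μ) :=
    iIndepFun_pi (X := fun _ b => b) fun _ => aemeasurable_id
  rw [(h.indepFun hij).map_prod_eq_prod_map_map (measurable_pi_apply i).aemeasurable
    (measurable_pi_apply j).aemeasurable]
  have e := fun v => (measurePreserving_eval (fun _ : ι => μ) v).map_eq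
  exact congrArg₂ _ (e i) (e j)

variable {N m : ℕ} {p : unitInterval}

instance : IsProbabilityMeasure (matrixLaw N) := by unfold matrixLaw; infer_instance

instance : IsProbabilityMeasure (sampleLaw p N m) := by unfold sampleLaw; infer_instance

/-- Used to deduce column statements from row statements, and to regroup row patterns by row instead
of by trace. -/
theorem measurePreserving_swap_args {ι κ β : Type*} [Fintype ι] [Fintype κ] [Countable β]
    [MeasurableSpace β] [MeasurableSingletonClass β] (μ : Measure β) [IsProbabilityMeasure μ] :
    MeasurePreserving (fun (X : ι → κ → β) j i => X i j)
      (Measure.pi fun _ => Measure.pi fun _ => μ) (Measure.pi fun _ => Measure.pi fun _ => μ) := by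
  have hm : Measurable fun (X : ι → κ → β) j i => X i j :=
    measurable_pi_lambda _ fun j => measurable_pi_lambda _ fun i =>
      (measurable_pi_apply j).comp (measurable_pi_apply i)
  refine ⟨hm, Measure.ext_of_singleton fun X => ?_⟩
  rw [Measure.map_apply hm (measurableSet_singleton _)]
  have e : (fun (X : ι → κ → β) j i => X i j) ⁻¹' {X} = {fun i j => X j i} := by
    ext Y
    simp only [Set.mem_preimage, Set.mem_singleton_iff, funext_iff]
    exact ⟨fun h i j => h j i, fun h i j => h j i⟩
  rw [e]
  simp only [Measure.pi_singleton]
  exact Finset.prod_comm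

theorem measurePreserving_transposeSample :
    MeasurePreserving (transposeSample : Sample N m → Sample N m) (sampleLaw p N m)
      (sampleLaw p N m) := by
  have h : MeasurePreserving (fun (κ : Fin m → Pattern N × Pattern N) a => (κ a).swap)
      (Measure.pi fun _ => (patternLaw p N).prod (patternLaw p N))
      (Measure.pi fun _ => (patternLaw p N).prod (patternLaw p N)) :=
    measurePreserving_pi _ _ fun _ => Measure.measurePreserving_swap
  exact (measurePreserving_swap_args (ι := Fin N) (κ := Fin N) fairBit).prod h

theorem measurePreserving_columnPatterns {a b : Fin m} (hab : a ≠ b) :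
    MeasurePreserving (fun κ : Fin m → Pattern N × Pattern N => ((κ a).2, (κ b).2))
      (Measure.pi fun _ => (patternLaw p N).prod (patternLaw p N))
      ((patternLaw p N).prod (patternLaw p N)) :=
  (measurePreserving_snd.prod measurePreserving_snd).comp
    (measurePreserving_pair ((patternLaw p N).prod (patternLaw p N)) hab)

/-- The event involves rows `i` and `j` whether or not they were retained, so it depends only on the
matrix and two column patterns. Its probability is that of the corresponding string test. -/
theorem rowTest_error_le {c q ε : ℝ}
    (h1 : ((stringLaw N).prod ((patternLaw p N).prod (patternLaw p N))).real
      {ω | ¬ TestSame c q N (stringTrace ω.1 ω.2.1) (stringTrace ω.1 ω.2.2)} ≤ ε)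
    (h2 : (((stringLaw N).prod (stringLaw N)).prod
      ((patternLaw p N).prod (patternLaw p N))).real
      {ω | TestSame c q N (stringTrace ω.1.1 ω.2.1) (stringTrace ω.1.2 ω.2.2)} ≤ ε)
    {a b : Fin m} (hab : a ≠ b) (i j : Fin N) :
    (sampleLaw p N m).real {ω | ¬ (TestSame c q N (stringTrace (ω.1 i) (ω.2 a).2)
      (stringTrace (ω.1 j) (ω.2 b).2) ↔ i = j)} ≤ ε := by
  by_cases hij : i = j
  · subst hij
    have hmp := (measurePreserving_eval (fun _ : Fin N => stringLaw N) i).prod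
      (measurePreserving_columnPatterns (p := p) (N := N) hab)
    have := hmp.measureReal_preimage (s := {ω | ¬ TestSame c q N (stringTrace ω.1 ω.2.1)
      (stringTrace ω.1 ω.2.2)}) MeasurableSet.of_discrete.nullMeasurableSet
    refine le_trans (le_of_eq ?_) (this.trans_le h1)
    simp only [iff_true]
    rfl
  · have hmp := (measurePreserving_pair (stringLaw N) hij).prod
      (measurePreserving_columnPatterns (p := p) (N := N) hab)
    have := hmp.measureReal_preimage (s := {ω | TestSame c q N (stringTrace ω.1.1 ω.2.1)
      (stringTrace ω.1.2 ω.2.2)}) MeasurableSet.of_discrete.nullMeasurableSet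
    refine le_trans (le_of_eq ?_) (this.trans_le h2)
    simp only [hij, iff_false, not_not]
    rfl

theorem not_rowsSeparated_le {c q ε : ℝ} (hε : 0 ≤ ε)
    (h1 : ((stringLaw N).prod ((patternLaw p N).prod (patternLaw p N))).real
      {ω | ¬ TestSame c q N (stringTrace ω.1 ω.2.1) (stringTrace ω.1 ω.2.2)} ≤ ε)
    (h2 : (((stringLaw N).prod (stringLaw N)).prod
      ((patternLaw p N).prod (patternLaw p N))).real
      {ω | TestSame c q N (stringTrace ω.1.1 ω.2.1) (stringTrace ω.1.2 ω.2.2)} ≤ ε) :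
    (sampleLaw p N m).real {ω | ¬ RowsSeparated c q ω} ≤ m ^ 2 * N ^ 2 * ε := by
  let B : (Fin m × Fin m) × (Fin N × Fin N) → Set (Sample N m) := fun s =>
    {ω | s.1.1 ≠ s.1.2 ∧ ¬ (TestSame c q N (stringTrace (ω.1 s.2.1) (ω.2 s.1.1).2)
      (stringTrace (ω.1 s.2.2) (ω.2 s.1.2).2) ↔ s.2.1 = s.2.2)}
  have hsub : {ω : Sample N m | ¬ RowsSeparated c q ω} ⊆ ⋃ s, B s := by
    intro ω hω
    by_contra hcon
    simp only [Set.mem_iUnion, not_exists] at hcon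
    refine hω fun a b hab i j => ?_
    by_contra h
    exact hcon ((a, b), (i, j)) ⟨hab, h⟩
  calc _ ≤ (sampleLaw p N m).real (⋃ s, B s) := measureReal_mono hsub
    _ ≤ ∑ s, (sampleLaw p N m).real (B s) := measureReal_iUnion_fintype_le _
    _ ≤ ∑ _s : (Fin m × Fin m) × (Fin N × Fin N), ε := by
        refine Finset.sum_le_sum fun s _ => ?_
        by_cases hab : s.1.1 = s.1.2
        · have : B s = ∅ := by ext ω; simp [B, hab]
          rw [this, measureReal_empty]; exact hε
        · exact le_trans (measureReal_mono fun ω hω => hω.2) (rowTest_error_le h1 h2 hab _ _)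
    _ = _ := by
        simp only [Finset.sum_const, Finset.card_univ, nsmul_eq_mul, Fintype.card_prod,
          Fintype.card_fin]
        push_cast
        ring

/-! ### Coverage -/

theorem patternLaw_true (i : Fin N) : (patternLaw p N).real {κ | κ i = true} = 1 - p := by
  have h := (measurePreserving_eval (fun _ : Fin N => bernoulliMeasure false true p) i
    ).measureReal_preimage (s := {true}) MeasurableSet.of_discrete.nullMeasurableSet
  rw [bernoulliMeasure_real_apply_of_notMem_of_mem _ MeasurableSet.of_discrete (by simp)
    (by simp)] at h
  exact h

theorem patternLaw_pair_ge (i j : Fin N) :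
    (1 - (p : ℝ)) ^ 2 ≤ (patternLaw p N).real {κ | κ i = true ∧ κ j = true} := by
  have hp0 : 0 ≤ (1 : ℝ) - p := sub_nonneg.2 p.2.2
  have hp1 : (1 : ℝ) - p ≤ 1 := sub_le_self _ p.2.1
  by_cases hij : i = j
  · subst hij
    simp only [and_self, patternLaw_true]
    nlinarith
  · have h : iIndepFun (fun (v : Fin N) (κ : Pattern N) => κ v) (patternLaw p N) :=
      iIndepFun_pi (X := fun _ b => b) fun _ => aemeasurable_id
    have h := (h.indepFun hij).measure_inter_preimage_eq_mul {true} {true}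
      MeasurableSet.of_discrete MeasurableSet.of_discrete
    have h' : (patternLaw p N).real {κ | κ i = true ∧ κ j = true}
        = (patternLaw p N).real {κ | κ i = true} * (patternLaw p N).real {κ | κ j = true} := by
      rw [measureReal_def, measureReal_def, measureReal_def, ← ENNReal.toReal_mul]
      exact congrArg _ h
    rw [h', patternLaw_true, patternLaw_true, sq]

theorem pi_forall_not_le {Ω : Type*} [MeasurableSpace Ω] [DiscreteMeasurableSpace Ω]
    {μ : Measure Ω} [IsProbabilityMeasure μ] {E : Set Ω} {r : ℝ} (h : r ≤ μ.real E) :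
    (Measure.pi fun _ : Fin m => μ).real {κ | ∀ a, κ a ∉ E} ≤ (1 - r) ^ m := by
  have e : {κ : Fin m → Ω | ∀ a, κ a ∉ E} = Set.univ.pi fun _ => Eᶜ := by
    ext κ; simp [Set.mem_pi]
  rw [e, measureReal_def, Measure.pi_pi, Finset.prod_const, Finset.card_univ, Fintype.card_fin,
    ENNReal.toReal_pow]
  refine pow_le_pow_left₀ ENNReal.toReal_nonneg ?_ _
  have := probReal_compl_eq_one_sub (μ := μ) (s := E) MeasurableSet.of_discrete
  rw [measureReal_def] at this
  linarith

/-- Each required joint survival has probability at least `q²` in one trace, and the traces are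
independent. The factor `3 N²` counts the requirements. -/
theorem not_covered_le :
    (sampleLaw p N m).real {ω | ¬ Covered ω.2}
      ≤ 3 * N ^ 2 * (1 - (1 - (p : ℝ)) ^ 2) ^ m := by
  set ν := (patternLaw p N).prod (patternLaw p N)
  let E : Fin 3 × (Fin N × Fin N) → Set (Pattern N × Pattern N) := fun s =>
    ![{κ | κ.1 s.2.1 = true ∧ κ.1 s.2.2 = true}, {κ | κ.2 s.2.1 = true ∧ κ.2 s.2.2 = true},
      {κ | κ.1 s.2.1 = true ∧ κ.2 s.2.2 = true}] s.1
  have hE : ∀ s, (1 - (p : ℝ)) ^ 2 ≤ ν.real (E s) := by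
    rintro ⟨r, i, j⟩
    fin_cases r
    · have := (measurePreserving_fst (μ := patternLaw p N) (ν := patternLaw p N)
        ).measureReal_preimage (s := {κ | κ i = true ∧ κ j = true})
        MeasurableSet.of_discrete.nullMeasurableSet
      exact (patternLaw_pair_ge i j).trans_eq this.symm
    · have := (measurePreserving_snd (μ := patternLaw p N) (ν := patternLaw p N)
        ).measureReal_preimage (s := {κ | κ i = true ∧ κ j = true})
        MeasurableSet.of_discrete.nullMeasurableSet
      exact (patternLaw_pair_ge i j).trans_eq this.symm
    · have := measureReal_prod_prod (μ := patternLaw p N) (ν := patternLaw p N)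
        {κ | κ i = true} {κ | κ j = true}
      rw [patternLaw_true, patternLaw_true, ← sq] at this
      exact this.ge
  have hsnd := (measurePreserving_snd (μ := matrixLaw N) (ν := Measure.pi fun _ : Fin m => ν)
    ).measureReal_preimage (s := {κ | ¬ Covered κ}) MeasurableSet.of_discrete.nullMeasurableSet
  have hsub : {κ : Fin m → Pattern N × Pattern N | ¬ Covered κ}
      ⊆ ⋃ s, {κ | ∀ a, κ a ∉ E s} := by
    intro κ hκ
    by_contra hcon
    simp only [Set.mem_iUnion, not_exists, Set.mem_ofPred_eq, not_forall, not_not] at hcon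
    exact hκ fun i j => ⟨hcon (0, i, j), hcon (1, i, j), hcon (2, i, j)⟩
  calc _ = (Measure.pi fun _ : Fin m => ν).real {κ | ¬ Covered κ} := hsnd
    _ ≤ (Measure.pi fun _ : Fin m => ν).real (⋃ s, {κ | ∀ a, κ a ∉ E s}) :=
        measureReal_mono hsub
    _ ≤ ∑ s, (Measure.pi fun _ : Fin m => ν).real {κ | ∀ a, κ a ∉ E s} :=
        measureReal_iUnion_fintype_le _
    _ ≤ ∑ _s : Fin 3 × (Fin N × Fin N), (1 - (1 - (p : ℝ)) ^ 2) ^ m :=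
        Finset.sum_le_sum fun s _ => pi_forall_not_le (hE s)
    _ = _ := by
        simp only [Finset.sum_const, Finset.card_univ, nsmul_eq_mul, Fintype.card_prod,
          Fintype.card_fin]
        push_cast
        ring

end Marginals

/-! ### Reconstruction succeeds with high probability -/

section Success

variable {N m : ℕ} {p : unitInterval}

/-- The samples for which the alignment by the median test determines the matrix. -/
def alignedSamples (N m : ℕ) (c q : ℝ) : Set (Sample N m) :=
  {ω | (∀ lab : Labelling N (traces ω), lab.IsAligned c q ↔ lab = trueLabelling ω) ∧
    ∀ Y : Fin N → Fin N → Bool, (trueLabelling ω).Fits Y ↔ Y = ω.1}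

theorem alignedSamples_compl_le {c q ε : ℝ} (hε : 0 ≤ ε)
    (h1 : ((stringLaw N).prod ((patternLaw p N).prod (patternLaw p N))).real
      {ω | ¬ TestSame c q N (stringTrace ω.1 ω.2.1) (stringTrace ω.1 ω.2.2)} ≤ ε)
    (h2 : (((stringLaw N).prod (stringLaw N)).prod
      ((patternLaw p N).prod (patternLaw p N))).real
      {ω | TestSame c q N (stringTrace ω.1.1 ω.2.1) (stringTrace ω.1.2 ω.2.2)} ≤ ε) :
    (sampleLaw p N m).real (alignedSamples N m c q)ᶜ
      ≤ 2 * (m ^ 2 * N ^ 2 * ε) + 3 * N ^ 2 * (1 - (1 - (p : ℝ)) ^ 2) ^ m := by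
  have hrow := not_rowsSeparated_le (m := m) hε h1 h2
  have hcol := (measurePreserving_transposeSample (p := p) (N := N) (m := m)
    ).measureReal_preimage (s := {ω | ¬ RowsSeparated c q ω})
    MeasurableSet.of_discrete.nullMeasurableSet
  have hsub : (alignedSamples N m c q)ᶜ ⊆ ({ω | ¬ RowsSeparated c q ω} ∪
      transposeSample ⁻¹' {ω | ¬ RowsSeparated c q ω}) ∪ {ω | ¬ Covered ω.2} := by
    intro ω hω
    by_contra hcon
    simp only [Set.mem_union, Set.mem_ofPred_eq, Set.mem_preimage, not_or, not_not] at hcon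
    exact hω (aligned_iff_and_fits_iff hcon.1.1 hcon.1.2 hcon.2)
  have a := measureReal_mono (μ := sampleLaw p N m) hsub (measure_ne_top _ _)
  have b := measureReal_union_le (μ := sampleLaw p N m) ({ω | ¬ RowsSeparated c q ω} ∪
      transposeSample ⁻¹' {ω | ¬ RowsSeparated c q ω}) {ω | ¬ Covered ω.2}
  have d := measureReal_union_le (μ := sampleLaw p N m) {ω | ¬ RowsSeparated c q ω}
    (transposeSample ⁻¹' {ω | ¬ RowsSeparated c q ω})
  linarith [not_covered_le (p := p) (N := N) (m := m)]

theorem tendsto_alignedSamples (hp : p < 1) {c : ℝ} (hc : 100 ≤ c) :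
    Tendsto (fun N : ℕ => (sampleLaw p N ⌈2 / (1 - (p : ℝ)) ^ 2 * logSize N⌉₊).real
      (alignedSamples N ⌈2 / (1 - (p : ℝ)) ^ 2 * logSize N⌉₊ c (1 - p))) atTop (𝓝 1) := by
  have hp' : (p : ℝ) < 1 := hp
  have hq : 0 < 1 - (p : ℝ) := sub_pos.2 hp'
  have hq1 : 1 - (p : ℝ) ≤ 1 := sub_le_self _ p.2.1
  set q : ℝ := 1 - p
  -- This `C` gives `(1 - q²) ^ m ≤ n ^ (-2)`, which beats the `3 n` coverage events. It does not
  -- depend on `c`.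
  set C : ℝ := 2 / q ^ 2
  have hC : 0 < C := by positivity
  have hlim : Tendsto (fun N : ℕ => 1 - (2 * (2 * C + 1) ^ 2 + 3) * (1 / (N : ℝ) ^ 2)) atTop
      (𝓝 1) := by
    have h : Tendsto (fun N : ℕ => 1 / (N : ℝ) ^ 2) atTop (𝓝 0) :=
      tendsto_const_nhds.div_atTop
        ((tendsto_pow_atTop two_ne_zero).comp tendsto_natCast_atTop_atTop)
    simpa using (h.const_mul (2 * (2 * C + 1) ^ 2 + 3)).const_sub 1
  refine tendsto_of_tendsto_of_tendsto_of_le_of_le' hlim tendsto_const_nhds ?_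
    (Eventually.of_forall fun N => measureReal_le_one)
  filter_upwards [eventually_not_testSame_le hp hc, eventually_testSame_le hp hc,
    eventually_ge_atTop 1] with N h1 h2 hN
  have hN1 : (1 : ℝ) ≤ N := by exact_mod_cast hN
  refine one_sub_le_of_compl_le ((alignedSamples_compl_le (by positivity) h1 h2).trans ?_)
  set m := ⌈C * logSize N⌉₊
  have hl0 : 0 ≤ logSize N := by
    rw [logSize_eq]; exact mul_nonneg zero_le_two (Real.log_nonneg hN1)
  have hm : (m : ℝ) ≤ (2 * C + 1) * N := by
    have h3 : (m : ℝ) < C * logSize N + 1 := Nat.ceil_lt_add_one (by positivity)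
    have h4 : logSize N ≤ 2 * N := by
      rw [logSize_eq]; linarith [Real.log_le_self (zero_le_one.trans hN1)]
    nlinarith
  have e2 := exp_neg_logSize (N := N) (by omega) 2
  have hpow : (1 - q ^ 2) ^ m ≤ (1 / (N : ℝ) ^ 2) ^ 2 := by
    rw [← e2]
    have h3 : 1 - q ^ 2 ≤ Real.exp (-q ^ 2) := by
      have := Real.add_one_le_exp (-q ^ 2); linarith
    have h0 : 0 ≤ 1 - q ^ 2 := by nlinarith
    calc (1 - q ^ 2) ^ m ≤ Real.exp (-q ^ 2) ^ m := by gcongr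
      _ = Real.exp (m * -q ^ 2) := by rw [Real.exp_nat_mul]
      _ ≤ _ := by
        refine Real.exp_le_exp.2 ?_
        have h4 := Nat.le_ceil (C * logSize N)
        have h5 := mul_le_mul_of_nonneg_right h4 (sq_nonneg q)
        have h6 : C * logSize N * q ^ 2 = 2 * logSize N := by simp only [C]; field_simp
        push_cast
        nlinarith
  have ht : 1 / ((N : ℝ) ^ 2) ^ 10 = (1 / (N : ℝ) ^ 2) ^ 10 := (one_div_pow _ _).symm
  rw [ht]
  set t : ℝ := 1 / (N : ℝ) ^ 2 with htdef
  have ht0 : 0 < t := by positivity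
  have ht1 : t ≤ 1 := by rw [htdef, div_le_one (by positivity)]; exact one_le_pow₀ hN1
  have hNt : (N : ℝ) ^ 2 * t = 1 := by rw [htdef]; field_simp
  have hA : (m : ℝ) ^ 2 * N ^ 2 * t ^ 10 ≤ (2 * C + 1) ^ 2 * t := by
    calc (m : ℝ) ^ 2 * N ^ 2 * t ^ 10 ≤ ((2 * C + 1) * N) ^ 2 * N ^ 2 * t ^ 10 := by gcongr
      _ = (2 * C + 1) ^ 2 * (N ^ 2 * t) ^ 2 * t ^ 8 := by ring
      _ = (2 * C + 1) ^ 2 * t ^ 8 := by rw [hNt]; ring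
      _ ≤ _ := by
        gcongr
        exact pow_le_of_le_one ht0.le ht1 (by norm_num)
  have hB : 3 * (N : ℝ) ^ 2 * (1 - q ^ 2) ^ m ≤ 3 * t := by
    calc 3 * (N : ℝ) ^ 2 * (1 - q ^ 2) ^ m ≤ 3 * (N : ℝ) ^ 2 * t ^ 2 := by gcongr
      _ = 3 * (N ^ 2 * t) * t := by ring
      _ = 3 * t := by rw [hNt]; ring
  linarith

open Classical in
/-- A matrix that fits some labelling of the traces aligned by the median test. -/
noncomputable def reconstruct (c q : ℝ) (N : ℕ) {m : ℕ} (T : Fin m → MatrixTrace) :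
    Fin N → Fin N → Bool :=
  if h : ∃ Y : Fin N → Fin N → Bool, ∃ lab : Labelling N T, lab.IsAligned c q ∧ lab.Fits Y then
    h.choose
  else fun _ _ => false

theorem reconstruct_traces {c q : ℝ} {ω : Sample N m} (h : ω ∈ alignedSamples N m c q) :
    reconstruct c q N (traces ω) = ω.1 := by
  have hex : ∃ Y : Fin N → Fin N → Bool, ∃ lab : Labelling N (traces ω),
      lab.IsAligned c q ∧ lab.Fits Y :=
    ⟨ω.1, trueLabelling ω, (h.1 _).2 rfl, (h.2 _).2 rfl⟩
  rw [reconstruct, dif_pos hex]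
  obtain ⟨lab, hal, hfit⟩ := hex.choose_spec
  rw [(h.1 lab).1 hal] at hfit
  exact (h.2 _).1 hfit

end Success

/-! ### Optimality -/

section Optimality

variable {N m : ℕ} {p : unitInterval}

/-- The row `i` is deleted in all traces. -/
def RowLost (κ : Fin m → Pattern N × Pattern N) (i : Fin N) : Prop := ∀ a, (κ a).1 i = false

theorem fairBit_singleton (b : Bool) : fairBit {b} = fairBit {true} := by
  cases b
  · refine (measureReal_eq_measureReal_iff).1 ?_
    rw [fairBit, bernoulliMeasure_real_apply_of_notMem_of_mem _ MeasurableSet.of_discrete (by simp)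
      (by simp), bernoulliMeasure_real_apply_of_mem_of_notMem _ MeasurableSet.of_discrete (by simp)
      (by simp)]
    norm_num
  · rfl

theorem matrixLaw_singleton (X : Fin N → Fin N → Bool) :
    matrixLaw N {X} = fairBit {true} ^ (N * N) := by
  simp only [matrixLaw, stringLaw, Measure.pi_singleton, fairBit_singleton]
  simp [pow_mul]

theorem traces_update {κ : Fin m → Pattern N × Pattern N} {i : Fin N} (hi : RowLost κ i)
    (X : Fin N → Fin N → Bool) (s : Fin N → Bool) :
    traces (Function.update X i s, κ) = traces (X, κ) := by
  funext a
  unfold traces matrixTrace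
  congr 1
  funext k l
  have : origin (κ a).1 k ≠ i := by
    intro h
    have h1 : (κ a).1 (origin (κ a).1 k) = true :=
      mem_kept_iff.1 (Finset.orderEmbOfFin_mem _ _ _)
    rw [h, hi a] at h1
    exact Bool.false_ne_true h1
  simp only [Function.update_of_ne this]

/-- Exchanging row `i` with a fresh row is an involution that leaves the traces unchanged. Averaged
over the fresh row, the success weights add up to at most the total mass `1` of one output law,
shared among `2 ^ N` rows. -/
theorem lintegral_guess_le {κ : Fin m → Pattern N × Pattern N} {i : Fin N} (hi : RowLost κ i)
    (Φ : (Fin m → MatrixTrace) → PMF (Fin N → Fin N → Bool)) :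
    ∫⁻ X, Φ (traces (X, κ)) X ∂(matrixLaw N) ≤ (2 ^ N)⁻¹ := by
  let f : (Fin N → Fin N → Bool) → ENNReal := fun X => Φ (traces (X, κ)) X
  let σ : (Fin N → Fin N → Bool) × (Fin N → Bool) → (Fin N → Fin N → Bool) × (Fin N → Bool) :=
    fun y => (Function.update y.1 i y.2, y.1 i)
  have hσ : Function.Involutive σ := by
    rintro ⟨X, s⟩
    simp [σ]
  have hsum : ∑ y : (Fin N → Fin N → Bool) × (Fin N → Bool), f y.1
      = ∑ y : (Fin N → Fin N → Bool) × (Fin N → Bool), f (Function.update y.1 i y.2) :=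
    (Equiv.sum_comp hσ.toPerm fun y => f y.1).symm
  rw [Fintype.sum_prod_type, Fintype.sum_prod_type] at hsum
  have hone : ∀ X : Fin N → Fin N → Bool, ∑ s, f (Function.update X i s) ≤ 1 := by
    intro X
    simp only [f, traces_update hi]
    rw [← (Φ (traces (X, κ))).tsum_coe, ← tsum_fintype (L := .unconditional _)]
    exact ENNReal.tsum_comp_le_tsum_of_injective (Function.update_injective X i) _
  have hle : (2 : ENNReal) ^ N * ∑ X, f X ≤ ∑ _X : Fin N → Fin N → Bool, 1 := by
    have e : (2 : ENNReal) ^ N * ∑ X, f X = ∑ X, ∑ _s : Fin N → Bool, f X := by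
      simp [Finset.mul_sum]
    rw [e, hsum]
    exact Finset.sum_le_sum fun X _ => hone X
  have htot : (∑ _X : Fin N → Fin N → Bool, 1) * fairBit {true} ^ (N * N) = 1 := by
    have h := lintegral_fintype (μ := matrixLaw N) fun _ => 1
    simp only [lintegral_const, measure_univ, mul_one, one_mul, matrixLaw_singleton] at h
    rw [Finset.sum_mul]; simpa using h.symm
  have hint : ∫⁻ X, f X ∂(matrixLaw N) = (∑ X, f X) * fairBit {true} ^ (N * N) := by
    rw [lintegral_fintype, Finset.sum_mul]
    simp only [matrixLaw_singleton]
  change ∫⁻ X, f X ∂(matrixLaw N) ≤ _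
  rw [hint, ENNReal.le_inv_iff_mul_le, mul_comm, ← mul_assoc]
  calc _ ≤ (∑ _X : Fin N → Fin N → Bool, 1) * fairBit {true} ^ (N * N) := by gcongr
    _ = 1 := htot

/-- Regrouped by row, the patterns are independent, and each row is lost everywhere with probability
`p ^ m`. -/
theorem no_rowLost_le :
    (Measure.pi fun _ : Fin m => (patternLaw p N).prod (patternLaw p N)).real
      {κ | ∀ i, ¬ RowLost κ i} ≤ (1 - (p : ℝ) ^ m) ^ N := by
  have h1 : MeasurePreserving (fun (κ : Fin m → Pattern N × Pattern N) a => (κ a).1)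
      (Measure.pi fun _ => (patternLaw p N).prod (patternLaw p N))
      (Measure.pi fun _ => patternLaw p N) :=
    measurePreserving_pi _ _ fun _ => measurePreserving_fst
  have h2 := (measurePreserving_swap_args (ι := Fin m) (κ := Fin N)
    (bernoulliMeasure false true p)).comp h1
  have h3 := h2.measureReal_preimage (s := {g | ∀ i, g i ∉ {f : Fin m → Bool | ∀ a, f a = false}})
    MeasurableSet.of_discrete.nullMeasurableSet
  refine h3.trans_le (pi_forall_not_le ?_)
  have e : {f : Fin m → Bool | ∀ a, f a = false} = Set.univ.pi fun _ => {false} := by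
    ext f; simp [Set.mem_pi]
  rw [e, measureReal_def, Measure.pi_pi, Finset.prod_const, Finset.card_univ, Fintype.card_fin,
    ENNReal.toReal_pow, ← measureReal_def,
    bernoulliMeasure_real_apply_of_mem_of_notMem _ MeasurableSet.of_discrete (by simp) (by simp)]

theorem success_le (Φ : (Fin m → MatrixTrace) → PMF (Fin N → Fin N → Bool)) :
    ∫⁻ ω, Φ (traces ω) ω.1 ∂(sampleLaw p N m)
      ≤ ENNReal.ofReal ((1 / 2) ^ N + (1 - (p : ℝ) ^ m) ^ N) := by
  set ν := Measure.pi fun _ : Fin m => (patternLaw p N).prod (patternLaw p N) with hν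
  let B : Set (Fin m → Pattern N × Pattern N) := {κ | ∀ i, ¬ RowLost κ i}
  have hp1 : (p : ℝ) ^ m ≤ 1 := pow_le_one₀ p.2.1 p.2.2
  rw [sampleLaw, lintegral_prod_symm _ Measurable.of_discrete.aemeasurable,
    ENNReal.ofReal_add (by positivity) (pow_nonneg (sub_nonneg.2 hp1) _)]
  calc _ ≤ ∫⁻ κ, ((2 ^ N)⁻¹ + B.indicator 1 κ) ∂ν := by
        refine lintegral_mono fun κ => ?_
        by_cases hκ : κ ∈ B
        · refine le_add_left ?_
          rw [Set.indicator_of_mem hκ]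
          calc _ ≤ ∫⁻ _X, 1 ∂(matrixLaw N) := lintegral_mono fun X => PMF.coe_le_one _ _
            _ = _ := by simp
        · refine le_add_right ?_
          obtain ⟨i, hi⟩ := not_forall_not.1 hκ
          exact lintegral_guess_le hi Φ
    _ = (2 ^ N)⁻¹ + ν B := by
        rw [lintegral_add_left measurable_const, lintegral_const, measure_univ, mul_one,
          lintegral_indicator_one MeasurableSet.of_discrete]
    _ ≤ _ := by
        refine add_le_add (le_of_eq ?_) ?_
        · rw [ENNReal.ofReal_pow (by norm_num), one_div, ENNReal.ofReal_inv_of_pos (by norm_num),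
            ENNReal.inv_pow]
          norm_num
        · rw [← ofReal_measureReal]
          exact ENNReal.ofReal_le_ofReal no_rowLost_le

/-- The constant `1 / (4 log (1/p))` is chosen so that `p ^ m ≥ N ^ (-1/2)`. The expected number of
lost rows is then at least `√N`. -/
theorem one_sub_pow_le {N : ℕ} (hp0 : 0 < (p : ℝ)) (hp : (p : ℝ) < 1) (hN : 1 ≤ N)
    (hm : (m : ℝ) ≤ 1 / (4 * -Real.log p) * logSize N) :
    (1 - (p : ℝ) ^ m) ^ N ≤ Real.exp (-√(N : ℝ)) := by
  have hlog : 0 < -Real.log p := neg_pos.2 (Real.log_neg hp0 hp)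
  have hp1 : (p : ℝ) ^ m ≤ 1 := pow_le_one₀ hp0.le hp.le
  have hN0 : (0 : ℝ) < N := by exact_mod_cast hN
  have hpm : Real.exp (-(Real.log N / 2)) ≤ (p : ℝ) ^ m := by
    rw [← Real.exp_log hp0, ← Real.exp_nat_mul]
    refine Real.exp_le_exp.2 ?_
    have h1 := mul_le_mul_of_nonneg_right hm hlog.le
    have h2 : 1 / (4 * -Real.log p) * logSize N * -Real.log p = Real.log N / 2 := by
      have hne : Real.log p ≠ 0 := (Real.log_neg hp0 hp).ne
      rw [logSize_eq]; field_simp; ring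
    linarith
  have hsq : √(N : ℝ) = N * Real.exp (-(Real.log N / 2)) := by
    rw [Real.exp_neg, Real.exp_half, Real.exp_log hN0, ← div_eq_mul_inv, Real.div_sqrt]
  calc (1 - (p : ℝ) ^ m) ^ N ≤ Real.exp (-(p : ℝ) ^ m) ^ N := by
        refine pow_le_pow_left₀ (sub_nonneg.2 hp1) ?_ _
        have := Real.add_one_le_exp (-(p : ℝ) ^ m); linarith
    _ = Real.exp (N * -(p : ℝ) ^ m) := by rw [Real.exp_nat_mul]
    _ ≤ _ := by
        refine Real.exp_le_exp.2 ?_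
        rw [hsq]
        nlinarith

theorem tendsto_success (hp0 : 0 < (p : ℝ)) (hp : (p : ℝ) < 1) (m : ℕ → ℕ)
    (hm : ∀ᶠ N : ℕ in atTop, (m N : ℝ) ≤ 1 / (4 * -Real.log p) * logSize N)
    (Φ : (N : ℕ) → (Fin (m N) → MatrixTrace) → PMF (Fin N → Fin N → Bool)) :
    Tendsto (fun N : ℕ => ∫⁻ ω, Φ N (traces ω) ω.1 ∂(sampleLaw p N (m N))) atTop (𝓝 0) := by
  have hlim : Tendsto (fun N : ℕ => ENNReal.ofReal ((1 / 2) ^ N + Real.exp (-√(N : ℝ)))) atTop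
      (𝓝 0) := by
    have h1 : Tendsto (fun N : ℕ => (1 / 2 : ℝ) ^ N) atTop (𝓝 0) :=
      tendsto_pow_atTop_nhds_zero_of_lt_one (by norm_num) (by norm_num)
    have h2 : Tendsto (fun N : ℕ => Real.exp (-√(N : ℝ))) atTop (𝓝 0) :=
      Real.tendsto_exp_neg_atTop_nhds_zero.comp
        (Real.tendsto_sqrt_atTop.comp tendsto_natCast_atTop_atTop)
    simpa using ENNReal.tendsto_ofReal (h1.add h2)
  refine tendsto_of_tendsto_of_tendsto_of_le_of_le' tendsto_const_nhds hlim
    (Eventually.of_forall fun N => zero_le) ?_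
  filter_upwards [hm, eventually_ge_atTop 1] with N hmN hN
  refine (success_le (Φ N)).trans (ENNReal.ofReal_le_ofReal ?_)
  gcongr
  exact one_sub_pow_le hp0 hp hN hmN

end Optimality

theorem mainTheorem3 (p : unitInterval) (hp : p < 1) :
    -- `O(log n)` traces suffice, and the rows and columns are aligned by the median test
    (∃ C : ℝ, 0 < C ∧
      (∃ Φ : (N : ℕ) → (Fin ⌈C * logSize N⌉₊ → MatrixTrace) → (Fin N → Fin N → Bool),
        Tendsto (fun N : ℕ => (sampleLaw p N ⌈C * logSize N⌉₊).real {ω | Φ N (traces ω) = ω.1})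
          atTop (𝓝 1)) ∧
      ∃ c₀ : ℝ, 0 < c₀ ∧ ∀ c : ℝ, c₀ ≤ c →
        -- the median test: same string, and independent strings
        (∀ᶠ N : ℕ in atTop,
          1 - 1 / ((N : ℝ) ^ 2) ^ 10 ≤
            ((stringLaw N).prod ((patternLaw p N).prod (patternLaw p N))).real
              {ω | TestSame c (1 - p) N (stringTrace ω.1 ω.2.1) (stringTrace ω.1 ω.2.2)} ∧
          1 - 1 / ((N : ℝ) ^ 2) ^ 10 ≤
            (((stringLaw N).prod (stringLaw N)).prod
              ((patternLaw p N).prod (patternLaw p N))).real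
              {ω | ¬ TestSame c (1 - p) N (stringTrace ω.1.1 ω.2.1) (stringTrace ω.1.2 ω.2.2)}) ∧
        -- with high probability the true labelling is the only one that agrees with the test,
        -- and the original matrix is the only one that fits it
        Tendsto (fun N : ℕ => (sampleLaw p N ⌈C * logSize N⌉₊).real
            {ω | (∀ lab : Labelling N (traces ω),
                    lab.IsAligned c (1 - p) ↔ lab = trueLabelling ω) ∧
                 ∀ Y : Fin N → Fin N → Bool, (trueLabelling ω).Fits Y ↔ Y = ω.1})
          atTop (𝓝 1)) ∧
    -- optimality: below a constant times `log n` traces, every (randomized) procedure fails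
    (0 < p → ∃ b : ℝ, 0 < b ∧ ∀ m : ℕ → ℕ, (∀ᶠ N : ℕ in atTop, (m N : ℝ) ≤ b * logSize N) →
      ∀ Φ : (N : ℕ) → (Fin (m N) → MatrixTrace) → PMF (Fin N → Fin N → Bool),
        Tendsto (fun N : ℕ => ∫⁻ ω, Φ N (traces ω) ω.1 ∂(sampleLaw p N (m N)))
          atTop (𝓝 0)) := by
  refine ⟨⟨2 / (1 - (p : ℝ)) ^ 2, ?_, ⟨fun N => reconstruct 100 (1 - p) N, ?_⟩, 100, by norm_num,
    fun c hc => ⟨?_, tendsto_alignedSamples hp hc⟩⟩, fun hp0 => ⟨1 / (4 * -Real.log p), ?_,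
    tendsto_success hp0 hp⟩⟩
  · have : 0 < 1 - (p : ℝ) := sub_pos.2 hp
    positivity
  · refine tendsto_of_tendsto_of_tendsto_of_le_of_le (tendsto_alignedSamples hp le_rfl)
      tendsto_const_nhds (fun N => ?_) fun N => measureReal_le_one
    exact measureReal_mono fun ω hω => reconstruct_traces hω
  · filter_upwards [eventually_not_testSame_le hp hc, eventually_testSame_le hp hc] with N h1 h2
    refine ⟨one_sub_le_of_compl_le ?_, one_sub_le_of_compl_le ?_⟩
    · exact h1
    · refine le_trans (le_of_eq ?_) h2
      congr 1
      ext ω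
      simp
  · have : Real.log p < 0 := Real.log_neg hp0 hp
    have : 0 < -Real.log p := by linarith
    positivity
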